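/- **Definitions.** A *germ* $(P,\mathcal O)$ consists of a set $\mathcal O$ of objects, a set $P$ of morphisms, each with a source and a target in $\mathcal O$, and a partially defined composition which assigns to certain pairs $x:A\to B$, $y:B\to C$ of morphisms of $P$ a morphism $xy:A\to C$ of $P$ (we write "$xy\in P$" when it is defined), such that (i) for every object $A$ there is $1_A:A\to A$ in $P$ such that $1_A a$ and $a1_B$ are defined and equal to $a$ for all $a:A\to B$ in $P$; (ii) for $a,b,c\in P$, $ab$ and $(ab)c$ are defined if and only if $bc$ and $a(bc)$ are, and then $(ab)c=a(bc)$. The category $C(P)$ generated by the germ has objects $\mathcal O$ and is given by the generators $P$ and the relations $ab=c$ whenever $ab\in P$ and $ab=c$, the morphisms $1_A$ of $P$ being the identities; $xy$ denotes the composite of $x:A\to B$ and $y:B\to C$. For $x,y\in P$, write $x\preccurlyeq y$ if $y=xz\in P$ for some $z\in P$; $y$ is then a right multiple of $x$ in $P$. A right lcm in $P$ is a least upper bound for $\preccurlyeq$ in $P$. The germ is *left locally Garside* if - (G1) there is no infinite sequence $x_1,x_2,\dots$ in $P$ with $x_n\preccurlyeq x_{n+1}$ and $x_n\neq x_{n+1}$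 for all $n$ that is bounded, i.e. such that for some $x\in P$ we have $x_n\preccurlyeq x$ for all $n$; - (G2) two morphisms of $P$ which have a common right multiple in $P$ have a right lcm in $P$; - (G3) if $u,v\in P$ have a right lcm $\Delta\in P$, and $x\in P$ is such that $xu,xv\in P$, then $x\Delta\in P$; - (G4) if $z\in C(P)$ and $x,y\in P$ satisfy $zx=zy$ in $C(P)$, then $x=y$. For a morphism $g$ of $C(P)$, let $E(g)$ be the set of finite sequences $(g_1,\dots,g_n)$ of composable morphisms of $P$, none of which is some $1_A$, with $g=g_1\cdots g_n$ in $C(P)$. It is a poset for the order generated by $(g_1,\dots,g_{i-1},a,b,g_{i+1},\dots,g_n)<(g_1,\dots,g_n)$ whenever $ab=g_i\in P$. A *path* in a poset $E$ is a sequence $x_1x_2\cdots x_k$ ($k\ge1$) of elements of $E$ such that $x_i$ and $x_{i+1}$ are comparable for each $i$. Homotopy is the finest equivalence relation on paths that is compatible with concatenation and satisfies $xyz\sim xz$ for $x\le y\le z$, and $xyx\sim x$, $yxy\sim y$ for $x\le y$. The group of homotopy classes of loops at $x$ is the fundamental group $\Pi_1(E,x)$. The poset $E$ is *connected* if any two elements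 are linked by a path, and *simply connected* if it is non-empty, connected, and $\Pi_1(E,x)$ is trivial for every $x\in E$. An order-preserving map $f:X\to Y$ induces a homomorphism $f^*:\Pi_1(X,x)\to\Pi_1(Y,f(x))$ for each $x\in X$. For $y\in Y$, put $Y_{\ge y}=\{y'\in Y\mid y'\ge y\}$. **Theorem.** 1. (Deligne) Let $P$ be a left locally Garside germ and let $g$ be a morphism of $C(P)$ which is not an identity. Then the poset $E(g)$ is simply connected. 2. (Bouc) Let $f:X\to Y$ be an order-preserving map between posets, with $Y$ connected. If $f^{-1}(Y_{\ge y})$ is non-empty and connected for every $y\in Y$, then $f^*:\Pi_1(X,x)\to\Pi_1(Y,f(x))$ is surjective for every $x\in X$. If $f^{-1}(Y_{\ge y})$ is simply connected for every $y\in Y$, then $f^*$ is an isomorphism for every $x\in X$. -/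

import Mathlib

open CategoryTheory

universe u v

/-! ### Homotopy in a poset -/

/-- The comparability graph of a preorder `E`: the vertices are the elements of `E`, and there is
exactly one edge from `x` to `y` if `x` and `y` are comparable, none otherwise. -/
structure OrderGraph (E : Type u) where
  elt : E

namespace OrderGraph

variable {E : Type u} [Preorder E]

instance : Quiver.{0} (OrderGraph E) where
  Hom x y := PLift (x.elt ≤ y.elt ∨ y.elt ≤ x.elt)

/-- An element of `E` as an object of the category of paths in `E`. -/
def vertex (x : E) : Paths (OrderGraph E) := (Paths.of (OrderGraph E)).obj ⟨x⟩

/-- The path `x y` with two terms, `x` and `y` being comparable. -/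
def two (x y : E) (h : x ≤ y ∨ y ≤ x) : vertex x ⟶ vertex y :=
  (Paths.of (OrderGraph E)).map (X := ⟨x⟩) (Y := ⟨y⟩) (PLift.up h)

/-- The elementary homotopies between paths of a poset:
`x y z ∼ x z` if `x ≤ y ≤ z`, and `x y x ∼ x`, `y x y ∼ y` if `x ≤ y`. -/
inductive ElemHomotopy : HomRel (Paths (OrderGraph E))
  | triangle (x y z : E) (hxy : x ≤ y) (hyz : y ≤ z) :
      ElemHomotopy (two x y (.inl hxy) ≫ two y z (.inl hyz)) (two x z (.inl (hxy.trans hyz)))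
  | up_down (x y : E) (h : x ≤ y) :
      ElemHomotopy (two x y (.inl h) ≫ two y x (.inr h)) (𝟙 (vertex x))
  | down_up (x y : E) (h : x ≤ y) :
      ElemHomotopy (two y x (.inr h) ≫ two x y (.inl h)) (𝟙 (vertex y))

end OrderGraph

/-- The groupoid of homotopy classes of paths in `E`: paths modulo the finest equivalence relation
that is compatible with concatenation and contains the elementary homotopies. -/
abbrev HomotopyGroupoid (E : Type u) [Preorder E] :=
  CategoryTheory.Quotient (OrderGraph.ElemHomotopy (E := E))

namespace HomotopyGroupoid

variable {E : Type u} [Preorder E]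

/-- The functor sending a path to its homotopy class. -/
abbrev cls (E : Type u) [Preorder E] : Paths (OrderGraph E) ⥤ HomotopyGroupoid E :=
  Quotient.functor (OrderGraph.ElemHomotopy (E := E))

/-- An element of `E` as an object of the groupoid. -/
def pt (x : E) : HomotopyGroupoid E := (cls E).obj (OrderGraph.vertex x)

/-- The homotopy class of the path `x y`. -/
def seg (x y : E) (h : x ≤ y ∨ y ≤ x) : pt x ⟶ pt y := (cls E).map (OrderGraph.two x y h)

theorem seg_comp (x y z : E) (hxy : x ≤ y) (hyz : y ≤ z) :
    seg x y (.inl hxy) ≫ seg y z (.inl hyz) = seg x z (.inl (hxy.trans hyz)) :=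
  ((cls E).map_comp _ _).symm.trans
    (CategoryTheory.Quotient.sound _ (OrderGraph.ElemHomotopy.triangle x y z hxy hyz))

theorem seg_up_down (x y : E) (h : x ≤ y) :
    seg x y (.inl h) ≫ seg y x (.inr h) = 𝟙 (pt x) :=
  (((cls E).map_comp _ _).symm.trans
    (CategoryTheory.Quotient.sound _ (OrderGraph.ElemHomotopy.up_down x y h))).trans
    ((cls E).map_id _)

theorem seg_down_up (x y : E) (h : x ≤ y) :
    seg y x (.inr h) ≫ seg x y (.inl h) = 𝟙 (pt y) :=
  (((cls E).map_comp _ _).symm.trans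
    (CategoryTheory.Quotient.sound _ (OrderGraph.ElemHomotopy.down_up x y h))).trans
    ((cls E).map_id _)

theorem isIso_seg (x y : E) (h : x ≤ y ∨ y ≤ x) : IsIso (seg x y h) := by
  rcases h with h | h
  · exact ⟨seg y x (.inr h), seg_up_down x y h, seg_down_up x y h⟩
  · exact ⟨seg y x (.inl h), seg_down_up y x h, seg_up_down y x h⟩

theorem isIso_map {x y : Paths (OrderGraph E)} (p : x ⟶ y) : IsIso ((cls E).map p) := by
  refine Paths.induction_fixed_source (fun {b} (q : x ⟶ b) => IsIso ((cls E).map q)) ?_ ?_ p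
  · infer_instance
  · intro a b q e hq
    have he : IsIso ((cls E).map ((Paths.of (OrderGraph E)).map e)) :=
      isIso_seg a.elt b.elt e.down
    rw [Functor.map_comp]
    exact IsIso.comp_isIso

instance : IsGroupoid (HomotopyGroupoid E) where
  all_isIso {X Y} f := by
    obtain ⟨p, rfl⟩ := (cls E).map_surjective (X := X.as) (Y := Y.as) f
    exact isIso_map p

end HomotopyGroupoid

/-- The fundamental group of the poset `E` at `x`: the group of homotopy classes of loops. -/
abbrev PosetPiOne (E : Type u) [Preorder E] (x : E) : Type u :=
  CategoryTheory.End (HomotopyGroupoid.pt x)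

noncomputable instance (E : Type u) [Preorder E] (x : E) : Group (PosetPiOne E x) :=
  { (inferInstance : Monoid (CategoryTheory.End (HomotopyGroupoid.pt x))) with
    inv := fun p => CategoryTheory.inv (show HomotopyGroupoid.pt x ⟶ HomotopyGroupoid.pt x from p)
    inv_mul_cancel := fun p =>
      IsIso.hom_inv_id (show HomotopyGroupoid.pt x ⟶ HomotopyGroupoid.pt x from p) }

section

variable {X : Type u} {Y : Type v} [Preorder X] [Preorder Y] (f : X →o Y)

/-- The class of the path `f x₁ f x₂ … f xₙ`, for a path `x₁ x₂ … xₙ` in `X`. -/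
def pathMap : Paths (OrderGraph X) ⥤ HomotopyGroupoid Y :=
  Paths.lift
    { obj := fun x => HomotopyGroupoid.pt (f x.elt)
      map := fun {x y} e => HomotopyGroupoid.seg (f x.elt) (f y.elt)
        (e.down.imp (fun h => f.monotone h) (fun h => f.monotone h)) }

theorem pathMap_two (x y : X) (h : x ≤ y ∨ y ≤ x) :
    (pathMap f).map (OrderGraph.two x y h) =
      HomotopyGroupoid.seg (f x) (f y) (h.imp (fun h => f.monotone h) (fun h => f.monotone h)) :=
  Category.id_comp _

theorem pathMap_elemHomotopy (x y : Paths (OrderGraph X)) (p q : x ⟶ y)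
    (h : OrderGraph.ElemHomotopy p q) : (pathMap f).map p = (pathMap f).map q := by
  cases h with
  | triangle x y z hxy hyz =>
    rw [Functor.map_comp, pathMap_two, pathMap_two, pathMap_two]
    exact HomotopyGroupoid.seg_comp _ _ _ (f.monotone hxy) (f.monotone hyz)
  | up_down x y h =>
    rw [Functor.map_comp, pathMap_two, pathMap_two, CategoryTheory.Functor.map_id]
    exact HomotopyGroupoid.seg_up_down _ _ (f.monotone h)
  | down_up x y h =>
    rw [Functor.map_comp, pathMap_two, pathMap_two, CategoryTheory.Functor.map_id]
    exact HomotopyGroupoid.seg_down_up _ _ (f.monotone h)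

/-- The functor between homotopy groupoids induced by an order-preserving map `f`. -/
def homotopyMap : HomotopyGroupoid X ⥤ HomotopyGroupoid Y :=
  CategoryTheory.Quotient.lift _ (pathMap f) (pathMap_elemHomotopy f)

/-- The homomorphism of fundamental groups induced by an order-preserving map. -/
def piOneMap (x : X) : PosetPiOne X x →* PosetPiOne Y (f x) :=
  (homotopyMap f).mapEnd (HomotopyGroupoid.pt x)

end

/-- Any two elements are linked by a path. -/
def PosetConnected (E : Type u) [Preorder E] : Prop :=
  ∀ x y : E, Nonempty (OrderGraph.vertex x ⟶ OrderGraph.vertex y)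

/-- Simply connected posets: non-empty, connected, with trivial fundamental groups. -/
structure PosetSimplyConnected (E : Type u) [Preorder E] : Prop where
  nonempty : Nonempty E
  connected : PosetConnected E
  piOne_trivial : ∀ x : E, Subsingleton (PosetPiOne E x)

/-! ### Germs -/

/-- There is no bounded infinite strictly increasing sequence, where "strictly increasing" means
that consecutive terms are related and different. (Such a preorder is a partial order.) -/
def NoetherianPreorder (α : Type u) [Preorder α] : Prop :=
  ¬ ∃ s : ℕ → α, BddAbove (Set.range s) ∧ ∀ n, s n ≤ s (n + 1) ∧ s n ≠ s (n + 1)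

/-- A germ with set of objects `O`. The morphisms from `A` to `B` form the type `A ⟶ B`, and there
is a partially defined composition, `mul a b = none` meaning that the product `ab` of `a : A ⟶ B`
and `b : B ⟶ C` is not defined. The last axiom says that `ab` and `(ab)c` are defined if and only
if `bc` and `a(bc)` are, and that `(ab)c = a(bc)` in this case. -/
class Germ (O : Type u) extends Quiver.{v} O where
  one : ∀ A : O, A ⟶ A
  mul : ∀ {A B C : O}, (A ⟶ B) → (B ⟶ C) → Option (A ⟶ C)
  mul_one : ∀ {A B : O} (a : A ⟶ B), mul a (one B) = some a
  one_mul : ∀ {A B : O} (a : A ⟶ B), mul (one A) a = some a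
  assoc : ∀ {A B C D : O} (a : A ⟶ B) (b : B ⟶ C) (c : C ⟶ D),
    (mul a b).bind (fun ab => mul ab c) = (mul b c).bind (fun bc => mul a bc)

namespace Germ

variable (O : Type u) [Germ.{u, v} O]

/-- The relations `ab = c` whenever the product `ab` is defined in the germ and equal to `c`; the
morphisms `1_A` of the germ become the identities. -/
inductive Rel : HomRel (Paths O)
  | mul {A B C : O} (a : A ⟶ B) (b : B ⟶ C) (c : A ⟶ C) (h : Germ.mul a b = some c) :
      Rel ((Paths.of O).map a ≫ (Paths.of O).map b) ((Paths.of O).map c)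
  | one (A : O) : Rel ((Paths.of O).map (Germ.one A)) (𝟙 ((Paths.of O).obj A))

/-- The category `C(P)` generated by a germ `P` with set of objects `O`. The composite of
`x : A ⟶ B` and `y : B ⟶ C`, written `xy` in the notation of germs, is `x ≫ y`. -/
abbrev Cat := CategoryTheory.Quotient (Rel O)

variable {O}

/-- An object of the germ as an object of the generated category. -/
def obj (A : O) : Cat O := (Quotient.functor (Rel O)).obj ((Paths.of O).obj A)

/-- The product, in the generated category, of the terms of a path in the germ. A path is a
sequence of morphisms such that the target of each is the source of the next. -/
def prod {A B : O} (p : Quiver.Path A B) : obj A ⟶ obj B :=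
  (Quotient.functor (Rel O)).map (X := (Paths.of O).obj A) (Y := (Paths.of O).obj B) p

/-- A morphism of the germ as a morphism of the generated category. -/
def toCat {A B : O} (a : A ⟶ B) : obj A ⟶ obj B :=
  (Quotient.functor (Rel O)).map ((Paths.of O).map a)

/-- The morphisms of the germ with source `A`. -/
def From (A : O) := Σ B : O, (A ⟶ B)

/-- Left divisibility in the germ: `x ≤ y` if there is `z` such that `xz` is defined and equal
to `y`. Morphisms with different sources are never comparable. -/
instance (A : O) : Preorder (From A) where
  le x y := ∃ z : x.1 ⟶ y.1, mul x.2 z = some y.2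
  le_refl x := ⟨one _, mul_one _⟩
  le_trans := by
    rintro x y w ⟨a, ha⟩ ⟨b, hb⟩
    have h := assoc x.2 a b
    rw [ha, Option.bind_some, hb] at h
    obtain ⟨c, -, hc⟩ := Option.bind_eq_some_iff.1 h.symm
    exact ⟨c, hc⟩

variable (O) in
/-- Left locally Garside germs. -/
structure LeftLocallyGarside : Prop where
  /-- The germ is left Noetherian. -/
  noetherian : ∀ A : O, NoetherianPreorder (From A)
  /-- Two morphisms with a common right multiple in the germ have a right lcm in the germ. -/
  exists_lcm : ∀ {A : O} (s t : From A), BddAbove {s, t} → ∃ d, IsLUB {s, t} d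
  /-- If `d` is a right lcm of `s` and `t` in the germ and if `xs` and `xt` are defined, then
  `xd` is defined. -/
  mul_lcm : ∀ {A B : O} (x : A ⟶ B) (s t d : From B), IsLUB {s, t} d →
    (mul x s.2).isSome → (mul x t.2).isSome → (mul x d.2).isSome
  /-- For `z` in the generated category and `x, y` in the germ, `zx = zy` implies `x = y`. -/
  cancel : ∀ {A B C : O} (z : obj A ⟶ obj B) (x y : B ⟶ C),
    z ≫ toCat x = z ≫ toCat y → x = y

/-- The morphism `g` of the generated category is an identity `1_A`. -/
def IsOne {A B : O} (g : obj A ⟶ obj B) : Prop :=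
  (⟨B, g⟩ : Σ C : O, (obj A ⟶ obj C)) = ⟨A, 𝟙 (obj A)⟩

/-- All terms of the path are different from the morphisms `1_C` of the germ. -/
def Proper {A : O} : ∀ {B : O}, Quiver.Path A B → Prop
  | _, .nil => True
  | _, .cons (b := C) (c := D) p a => Proper p ∧ (⟨D, a⟩ : From C) ≠ ⟨C, one C⟩

/-- The set `E(g)` of decompositions of `g` into a product of morphisms of the germ different
from `1`. -/
structure Decomp {A B : O} (g : obj A ⟶ obj B) where
  path : Quiver.Path A B
  proper : Proper path
  prod_eq : prod path = g

/-- `Split p q`: `q = (g₁, …, gᵢ, …, gₙ)` and `p = (g₁, …, a, b, …, gₙ)`, where the product `ab`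
is defined in the germ and equal to `gᵢ`. -/
inductive Split {A B : O} : Quiver.Path A B → Quiver.Path A B → Prop
  | mk {C D E : O} (l : Quiver.Path A C) (a : C ⟶ D) (b : D ⟶ E) (c : C ⟶ E)
      (h : mul a b = some c) (r : Quiver.Path E B) :
      Split (((l.cons a).cons b).comp r) ((l.cons c).comp r)

theorem Split.length {A B : O} {p q : Quiver.Path A B} (h : Split p q) :
    p.length = q.length + 1 := by
  cases h
  simp only [Quiver.Path.length_comp, Quiver.Path.length_cons]
  omega

namespace Decomp

variable {A B : O} {g : obj A ⟶ obj B}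

theorem length_lt {p q : Decomp g}
    (h : Relation.TransGen (fun p q : Decomp g => Split p.path q.path) p q) :
    q.path.length < p.path.length := by
  induction h with
  | single h => have := h.length; omega
  | tail _ h ih => have := h.length; omega

/-- `p ≤ q` if `p` is obtained from `q` by splitting terms repeatedly. -/
instance : PartialOrder (Decomp g) where
  le := Relation.ReflTransGen fun p q => Split p.path q.path
  le_refl _ := .refl
  le_trans _ _ _ := .trans
  le_antisymm p q hpq hqp := by
    rcases Relation.reflTransGen_iff_eq_or_transGen.1 hpq with h | h
    · exact h.symm
    · rcases Relation.reflTransGen_iff_eq_or_transGen.1 hqp with h' | h'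
      · exact h'
      · exact absurd (length_lt h) (length_lt h').asymm

end Decomp

end Germ

/-!
Both halves rest on the groupoid of homotopy classes of paths.

*Order-preserving maps.* For `f : X →o Y`, write `F y = f ⁻¹' Set.Ici y`, a family of subsets
decreasing in `y`. Paths in `F y` become trivial in `Y`, since their images lie above `y`. If the sets
`F y` are non-empty and connected, a path of `Y` is lifted edge by edge
(`exists_pushPath_eq`). If they are simply connected, choose `s y` in `F y`; the unique class of paths
in `F y` from `s y` to `s y'` for `y ≤ y'` defines a functor back to the groupoid of `X`, which is
inverse to `f` on the left up to conjugation (`piOneMap_injective`).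

*Decompositions.* A morphism `x` of the germ acts on factorizations `y r`, with `y` in the germ and
`r` in `C(P)`: write `y = v w` with `v` the greatest divisor of `y` such that `x v` is defined, and
send `y r` to `(x v)(w r)`. This is compatible with the products of the germ
(`Factorization.act_mul`), so `C(P)` acts. Acting on the trivial factorization shows that each `g` has
a greatest divisor in the germ (`exists_head`), and that `C(P)` is left cancellative
(`comp_left_cancel`). Moreover passing to proper right factors is well founded
(`wellFounded_properFactor`), which allows an induction on `g`.

If `g` is in the germ, then `E(g)` has a greatest element. Otherwise, for a divisor `x ≠ 1` of
`g = x h` in the germ, let `U x` be the set of decompositions of `g` whose first term is a multiple of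
`x`. Removing `x` from the first term shows that `U x` retracts onto `E(h)`
(`simplyConnected_addFirst`), which is simply connected by induction. First terms grow with the
decomposition, and a decomposition starting with the greatest divisor of `g` lies in every `U x`.
Therefore these sets, indexed by the first terms of the decompositions, satisfy the hypotheses of an
elementary van Kampen argument (`PosetSimplyConnected.of_cover`), and `E(g)` is simply connected.
-/

/-! ### Simply connected posets -/

namespace HomotopyGroupoid

variable {E : Type u} [Preorder E]

theorem seg_self (x : E) (h : x ≤ x ∨ x ≤ x) : seg x x h = 𝟙 (pt x) := by
  have := isIso_seg x x h
  rw [← cancel_epi (seg x x h), Category.comp_id]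
  exact seg_comp x x x le_rfl le_rfl

/-- To prove a property of all homotopy classes of paths with origin `x`, it suffices to treat the
constant path and the extension of a path by one term, above or below its end. -/
theorem induction {x : E} (P : ∀ y : E, (pt x ⟶ pt y) → Prop) (id : P x (𝟙 (pt x)))
    (up : ∀ (y z : E) (φ : pt x ⟶ pt y) (h : y ≤ z), P y φ → P z (φ ≫ seg y z (.inl h)))
    (down : ∀ (y z : E) (φ : pt x ⟶ pt y) (h : z ≤ y), P y φ → P z (φ ≫ seg y z (.inr h)))
    {y : E} (φ : pt x ⟶ pt y) : P y φ := by
  obtain ⟨p, rfl⟩ := (cls E).map_surjective (X := OrderGraph.vertex x) (Y := OrderGraph.vertex y) φ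
  refine Paths.induction_fixed_source
    (fun {b} (q : OrderGraph.vertex x ⟶ b) => P (OrderGraph.elt b) ((cls E).map q)) ?_ ?_ p
  · exact id
  · intro a b q e hq
    have h : (cls E).map (q ≫ (Paths.of (OrderGraph E)).map e) =
        (show pt x ⟶ pt a.elt from (cls E).map q) ≫ seg a.elt b.elt e.down :=
      (cls E).map_comp _ _
    refine (congrArg (P b.elt) h).mpr ?_
    rcases e.down with h | h
    · exact up _ _ _ h hq
    · exact down _ _ _ h hq

theorem nonempty_hom (h : PosetConnected E) (x y : E) : Nonempty (pt x ⟶ pt y) :=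
  (h x y).map fun p => (cls E).map p

theorem nonempty_path {x y : E} (φ : pt x ⟶ pt y) :
    Nonempty (OrderGraph.vertex x ⟶ OrderGraph.vertex y) :=
  let ⟨p, _⟩ := (cls E).map_surjective (X := OrderGraph.vertex x) (Y := OrderGraph.vertex y) φ
  ⟨p⟩

/-- A functor on the homotopy groupoid with values in a groupoid amounts to a functor on the
preorder `E`: the downward segments are sent to the inverses of the upward ones. -/
theorem exists_lift {C : Type*} [Category C] [IsGroupoid C] (F : E → C)
    (m : ∀ x y : E, x ≤ y → (F x ⟶ F y))
    (hm : ∀ x y z (hxy : x ≤ y) (hyz : y ≤ z),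
      m x y hxy ≫ m y z hyz = m x z (hxy.trans hyz)) :
    ∃ (G : ∀ x y : E, (pt x ⟶ pt y) → (F x ⟶ F y)),
      (∀ x, G x x (𝟙 _) = 𝟙 _) ∧
      (∀ x y z φ ψ, G x z (φ ≫ ψ) = G x y φ ≫ G y z ψ) ∧
      ∀ x y h, G x y (seg x y (.inl h)) = m x y h := by
  classical
  have hiso : ∀ x y h, IsIso (m x y h) := fun x y h => inferInstance
  have hid : ∀ x (h : x ≤ x), m x x h = 𝟙 _ := fun x h => by
    rw [← cancel_epi (m x x h), hm, Category.comp_id]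
  -- in a preorder both `x ≤ y` and `y ≤ x` may hold; the two possible values of `e` then agree
  let e : ∀ x y : E, (x ≤ y ∨ y ≤ x) → (F x ⟶ F y) := fun x y h =>
    if hxy : x ≤ y then m x y hxy else inv (m y x (h.resolve_left hxy))
  have he₁ : ∀ x y (h : x ≤ y ∨ y ≤ x) (hxy : x ≤ y), e x y h = m x y hxy :=
    fun x y h hxy => dif_pos hxy
  have he₂ : ∀ x y (h : x ≤ y ∨ y ≤ x) (hyx : y ≤ x), e x y h = inv (m y x hyx) := by
    intro x y h hyx
    by_cases hxy : x ≤ y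
    · rw [he₁ x y h hxy, ← cancel_mono (m y x hyx), hm, hid, IsIso.inv_hom_id]
    · exact dif_neg hxy
  let L : Paths (OrderGraph E) ⥤ C := Paths.lift
    { obj := fun x => F x.elt
      map := fun {x y} k => e x.elt y.elt k.down }
  have hL : ∀ x y h, L.map (OrderGraph.two x y h) = e x y h := fun x y h => Category.id_comp _
  have hL₂ : ∀ x y z h h', L.map (OrderGraph.two x y h ≫ OrderGraph.two y z h') =
      e x y h ≫ e y z h' := fun x y z h h' =>
    (L.map_comp _ _).trans (congrArg₂ (fun (a : F x ⟶ F y) b => a ≫ b) (hL x y h) (hL y z h'))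
  have hrel : ∀ (x y : Paths (OrderGraph E)) (p q : x ⟶ y), OrderGraph.ElemHomotopy p q →
      L.map p = L.map q := by
    intro x y p q h
    cases h with
    | triangle x y z hxy hyz =>
      refine (hL₂ x y z _ _).trans (Eq.trans ?_ (hL x z _).symm)
      rw [he₁ x y (.inl hxy) hxy, he₁ y z (.inl hyz) hyz,
        he₁ x z (.inl (hxy.trans hyz)) (hxy.trans hyz), hm]
    | up_down x y h =>
      refine (hL₂ x y x _ _).trans (Eq.trans ?_ (L.map_id _).symm)
      rw [he₁ x y (.inl h) h, he₂ y x (.inr h) h]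
      exact IsIso.hom_inv_id (m x y h)
    | down_up x y h =>
      refine (hL₂ y x y _ _).trans (Eq.trans ?_ (L.map_id _).symm)
      rw [he₁ x y (.inl h) h, he₂ y x (.inr h) h]
      exact IsIso.inv_hom_id (m x y h)
  let G : HomotopyGroupoid E ⥤ C := CategoryTheory.Quotient.lift _ L hrel
  refine ⟨fun x y φ => G.map φ, fun x => G.map_id _, fun x y z φ ψ => G.map_comp _ _,
    fun x y h => ?_⟩
  exact (hL x y (.inl h)).trans (he₁ x y (.inl h) h)

end HomotopyGroupoid

open HomotopyGroupoid

section

variable {X : Type u} {Y : Type v} [Preorder X] [Preorder Y] (f : X →o Y)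

/-- The map on homotopy classes of paths induced by an order-preserving map. -/
def pushPath {x y : X} (φ : pt x ⟶ pt y) : pt (f x) ⟶ pt (f y) := (homotopyMap f).map φ

theorem pushPath_seg (x y : X) (h : x ≤ y ∨ y ≤ x) :
    pushPath f (seg x y h) =
      seg (f x) (f y) (h.imp (fun h => f.monotone h) (fun h => f.monotone h)) :=
  pathMap_two f x y h

theorem pushPath_id (x : X) : pushPath f (𝟙 (pt x)) = 𝟙 _ := (homotopyMap f).map_id _

theorem pushPath_comp {x y z : X} (φ : pt x ⟶ pt y) (ψ : pt y ⟶ pt z) :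
    pushPath f (φ ≫ ψ) = pushPath f φ ≫ pushPath f ψ := (homotopyMap f).map_comp _ _

/-- The class in `X` of a path of the subset `S`. -/
def inclPath (S : Set X) {x y : S} (φ : pt x ⟶ pt y) : pt x.1 ⟶ pt y.1 :=
  pushPath (OrderHom.Subtype.val _) φ

variable (S : Set X)

theorem inclPath_seg (x y : S) (h : x ≤ y ∨ y ≤ x) :
    inclPath S (seg x y h) = seg x.1 y.1 h :=
  pushPath_seg _ x y h

theorem inclPath_id (x : S) : inclPath S (𝟙 (pt x)) = 𝟙 _ := pushPath_id _ _

theorem inclPath_comp {x y z : S} (φ : pt x ⟶ pt y) (ψ : pt y ⟶ pt z) :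
    inclPath S (φ ≫ ψ) = inclPath S φ ≫ inclPath S ψ := pushPath_comp _ _ _

/-- A path of a subset of `S` is a path of `S`. -/
theorem exists_inclPath_eq {S T : Set X} (hST : S ⊆ T) {x y : S} (φ : pt x ⟶ pt y) :
    ∃ ψ : pt (⟨x.1, hST x.2⟩ : T) ⟶ pt (⟨y.1, hST y.2⟩ : T), inclPath T ψ = inclPath S φ := by
  refine induction (fun y φ => ∃ ψ : pt (⟨x.1, hST x.2⟩ : T) ⟶ pt (⟨y.1, hST y.2⟩ : T),
    inclPath T ψ = inclPath S φ) ?_ ?_ ?_ φ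
  · exact ⟨𝟙 _, (inclPath_id T _).trans (inclPath_id S _).symm⟩
  · rintro y z φ h ⟨ψ, hψ⟩
    refine ⟨ψ ≫ seg (E := T) ⟨y.1, hST y.2⟩ ⟨z.1, hST z.2⟩ (.inl h), ?_⟩
    rw [inclPath_comp, inclPath_comp, hψ, inclPath_seg, inclPath_seg]
  · rintro y z φ h ⟨ψ, hψ⟩
    refine ⟨ψ ≫ seg (E := T) ⟨y.1, hST y.2⟩ ⟨z.1, hST z.2⟩ (.inr h), ?_⟩
    rw [inclPath_comp, inclPath_comp, hψ, inclPath_seg, inclPath_seg]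

end

namespace PosetSimplyConnected

section

variable {E : Type u} [Preorder E]

theorem hom_subsingleton (h : PosetSimplyConnected E) (x y : E) :
    Subsingleton (pt x ⟶ pt y) := by
  refine ⟨fun φ ψ => ?_⟩
  have := (h.piOne_trivial x).elim (φ ≫ inv ψ) (𝟙 _)
  rwa [IsIso.comp_inv_eq, Category.id_comp] at this

theorem nonempty_hom (h : PosetSimplyConnected E) (x y : E) : Nonempty (pt x ⟶ pt y) :=
  HomotopyGroupoid.nonempty_hom h.connected x y

/-- A poset is simply connected as soon as every point `q` can be joined to a base point by a
class of paths `γ q` in such a way that these classes match along the comparabilities. -/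
theorem of_coherent (e : E) (γ : ∀ q : E, pt e ⟶ pt q)
    (hγ : ∀ p q (h : p ≤ q), γ p ≫ seg p q (.inl h) = γ q) : PosetSimplyConnected E := by
  have key : ∀ (x : E) {y : E} (φ : pt x ⟶ pt y), γ x ≫ φ = γ y := by
    intro x y φ
    refine induction (fun y φ => γ x ≫ φ = γ y) (Category.comp_id _) ?_ ?_ φ
    · intro y z φ h ih
      rw [← Category.assoc, ih, hγ y z h]
    · intro y z φ h ih
      rw [← Category.assoc, ih, ← hγ z y h, Category.assoc, seg_up_down z y h, Category.comp_id]
  refine ⟨⟨e⟩, fun x y => nonempty_path (inv (γ x) ≫ γ y), fun x => ⟨fun φ ψ => ?_⟩⟩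
  exact (cancel_epi (γ x)).1 ((key x φ).trans (key x ψ).symm)

theorem of_isTop (e : E) (h : ∀ q, q ≤ e) : PosetSimplyConnected E := by
  refine of_coherent e (fun q => seg e q (.inr (h q))) fun p q hpq => ?_
  have := isIso_seg q e (.inl (h q))
  rw [← cancel_mono (seg q e (.inl (h q))), Category.assoc, seg_comp p q e hpq (h q),
    seg_down_up _ _ (h q), seg_down_up _ _ (h p)]

/-- A van Kampen argument: if the sets `U q` are simply connected, contain `q` and a common base
point, and decrease with `q`, then the whole poset is simply connected. -/
theorem of_cover (e : E) (U : E → Set E) (hU : ∀ q, PosetSimplyConnected (U q))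
    (he : ∀ q, e ∈ U q) (hq : ∀ q, q ∈ U q) (hmono : ∀ p q, p ≤ q → U q ⊆ U p) :
    PosetSimplyConnected E := by
  let γ : ∀ q, pt (⟨e, he q⟩ : U q) ⟶ pt (⟨q, hq q⟩ : U q) := fun q =>
    ((hU q).nonempty_hom _ _).some
  refine of_coherent e (fun q => inclPath (U q) (γ q)) fun p q h => ?_
  -- the path chosen for `q` lies in `U q`, hence in the simply connected set `U p`
  obtain ⟨ψ, hψ⟩ := exists_inclPath_eq (hmono p q h) (γ q)
  have hs : γ p ≫ seg (E := U p) ⟨p, hq p⟩ ⟨q, hmono p q h (hq q)⟩ (.inl h) = ψ :=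
    ((hU p).hom_subsingleton _ _).elim _ _
  rw [← hψ, ← hs, inclPath_comp, inclPath_seg]

end

/-- If every element lying above the image of `i` has a greatest element of the simply connected
poset `X` below it, then it retracts onto `X`, so that these elements form a simply connected
poset. -/
theorem of_isGreatest {X : Type u} {Y : Type v} [Preorder X] [Preorder Y]
    (hX : PosetSimplyConnected X) (i : X →o Y)
    (hi : ∀ u, (∃ r, i r ≤ u) → ∃ r, IsGreatest {r | i r ≤ u} r) :
    PosetSimplyConnected {u : Y | ∃ r, i r ≤ u} := by
  obtain ⟨e⟩ := hX.nonempty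
  choose r hr using fun u : {u : Y | ∃ r, i r ≤ u} => hi u.1 u.2
  let i' : X →o {u : Y | ∃ r, i r ≤ u} := ⟨fun x => ⟨i x, x, le_rfl⟩, fun _ _ h => i.monotone h⟩
  have hir : ∀ u, i' (r u) ≤ u := fun u => (hr u).1
  have hmono : ∀ u u', u ≤ u' → r u ≤ r u' := fun u u' h => (hr u').2 ((hr u).1.trans h)
  let γ : ∀ x, pt e ⟶ pt x := fun x => (hX.nonempty_hom _ _).some
  refine of_coherent (i' e) (fun u => pushPath i' (γ (r u)) ≫ seg _ _ (.inl (hir u)))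
    fun u u' h => ?_
  have hγ : γ (r u') = γ (r u) ≫ seg _ _ (.inl (hmono u u' h)) :=
    (hX.hom_subsingleton _ _).elim _ _
  rw [hγ, pushPath_comp, pushPath_seg, Category.assoc, Category.assoc,
    seg_comp _ _ _ (hir u) h, seg_comp _ _ _ (i'.monotone (hmono u u' h)) (hir u')]

end PosetSimplyConnected

/-! ### Order-preserving maps with connected or simply connected fibres -/

section

variable {X : Type u} {Y : Type v} [Preorder X] [Preorder Y] (f : X →o Y)

/-- In `Y`, the image of a path of the fibre over `Set.Ici y` can be contracted to the least
element `y` of `Set.Ici y`. -/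
theorem seg_pushPath_inclPath (y : Y) {S : Set X} (hS : ∀ a ∈ S, y ≤ f a) {a b : S}
    (φ : pt a ⟶ pt b) :
    seg y (f a) (.inl (hS a a.2)) ≫ pushPath f (inclPath S φ) =
      seg y (f b) (.inl (hS b b.2)) := by
  refine induction (fun b φ => seg y (f a) (.inl (hS a a.2)) ≫ pushPath f (inclPath S φ) =
    seg y (f b) (.inl (hS b b.2))) ?_ ?_ ?_ φ
  · rw [inclPath_id, pushPath_id, Category.comp_id]
  · intro b c φ h ih
    rw [inclPath_comp, pushPath_comp, ← Category.assoc, ih, inclPath_seg, pushPath_seg,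
      seg_comp _ _ _ (hS b b.2) (f.monotone h)]
  · intro b c φ h ih
    have h' : f c ≤ f b := f.monotone h
    rw [inclPath_comp, pushPath_comp, ← Category.assoc, ih, inclPath_seg, pushPath_seg,
      ← seg_comp y (f c) (f b) (hS c c.2) h', Category.assoc, seg_up_down _ _ h',
      Category.comp_id]

/-- When the fibres are connected, every class of paths in `Y` lifts to `X`, with prescribed ends
in the fibres over the ends of the path. -/
theorem exists_pushPath_eq
    (hf : ∀ y : Y, (f ⁻¹' Set.Ici y).Nonempty ∧ PosetConnected (f ⁻¹' Set.Ici y))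
    {y y' : Y} (δ : pt y ⟶ pt y') (a b : X) (ha : y ≤ f a) (hb : y' ≤ f b) :
    ∃ σ : pt a ⟶ pt b, seg y (f a) (.inl ha) ≫ pushPath f σ = δ ≫ seg y' (f b) (.inl hb) := by
  have fiber : ∀ (z : Y) (c d : X) (hc : z ≤ f c) (hd : z ≤ f d), ∃ τ : pt c ⟶ pt d,
      seg z (f c) (.inl hc) ≫ pushPath f τ = seg z (f d) (.inl hd) := by
    intro z c d hc hd
    obtain ⟨φ⟩ := nonempty_hom (hf z).2 ⟨c, hc⟩ ⟨d, hd⟩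
    exact ⟨_, seg_pushPath_inclPath f z (fun _ h => h) φ⟩
  revert b
  refine induction (fun y' δ => ∀ (b : X) (hb : y' ≤ f b), ∃ σ : pt a ⟶ pt b,
    seg y (f a) (.inl ha) ≫ pushPath f σ = δ ≫ seg y' (f b) (.inl hb)) ?_ ?_ ?_ δ
  · intro b hb
    rw [Category.id_comp]
    exact fiber y a b ha hb
  · intro z w δ h ih b hb
    obtain ⟨σ, hσ⟩ := ih b (h.trans hb)
    exact ⟨σ, by rw [hσ, Category.assoc, seg_comp z w _ h hb]⟩
  · intro z w δ h ih b hb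
    obtain ⟨c, hc⟩ := (hf z).1
    obtain ⟨σ, hσ⟩ := ih c hc
    obtain ⟨τ, hτ⟩ := fiber w c b (h.trans hc) hb
    refine ⟨σ ≫ τ, ?_⟩
    rw [pushPath_comp, ← Category.assoc, hσ, Category.assoc, Category.assoc, ← hτ,
      ← seg_comp w z (f c) h hc, Category.assoc, ← Category.assoc (seg z w _), seg_down_up _ _ h,
      Category.id_comp]

theorem piOneMap_surjective
    (hf : ∀ y : Y, (f ⁻¹' Set.Ici y).Nonempty ∧ PosetConnected (f ⁻¹' Set.Ici y)) (x : X) :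
    Function.Surjective (piOneMap f x) := by
  intro δ
  obtain ⟨σ, hσ⟩ := exists_pushPath_eq f hf (y := f x) (y' := f x) δ x x le_rfl le_rfl
  refine ⟨σ, ?_⟩
  rw [seg_self, Category.id_comp, Category.comp_id] at hσ
  exact hσ

/-- When the fibres are simply connected, a choice of a point `s y` in the fibre over each
`y` extends to a functor between homotopy groupoids, which is a left inverse of the functor induced
by `f` up to the natural isomorphism given by the paths from `s (f a)` to `a` in the fibres. -/
theorem piOneMap_injective (hf : ∀ y : Y, PosetSimplyConnected (f ⁻¹' Set.Ici y)) (x : X) :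
    Function.Injective (piOneMap f x) := by
  let F : Y → Set X := fun y => f ⁻¹' Set.Ici y
  have hF : ∀ {y z : Y}, y ≤ z → F z ⊆ F y := fun h _ hx => h.trans hx
  -- `κ y a b` is the only class of paths from `a` to `b` coming from the fibre over `y`
  have hκ : ∀ (y : Y) (a b : X) (ha : a ∈ F y) (hb : b ∈ F y), ∃ κ : pt a ⟶ pt b,
      ∀ φ : pt (⟨a, ha⟩ : F y) ⟶ pt (⟨b, hb⟩ : F y), inclPath (F y) φ = κ := by
    intro y a b ha hb
    obtain ⟨φ⟩ := (hf y).nonempty_hom ⟨a, ha⟩ ⟨b, hb⟩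
    exact ⟨inclPath (F y) φ, fun ψ => congrArg _ (((hf y).hom_subsingleton _ _).elim ψ φ)⟩
  choose κ hκ using hκ
  have κ_comp : ∀ y a b c ha hb hc, κ y a b ha hb ≫ κ y b c hb hc = κ y a c ha hc := by
    intro y a b c ha hb hc
    obtain ⟨φ⟩ := (hf y).nonempty_hom ⟨a, ha⟩ ⟨b, hb⟩
    obtain ⟨ψ⟩ := (hf y).nonempty_hom ⟨b, hb⟩ ⟨c, hc⟩
    rw [← hκ y a b ha hb φ, ← hκ y b c hb hc ψ, ← hκ y a c ha hc (φ ≫ ψ), inclPath_comp]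
  have κ_seg : ∀ y a b ha hb (h : a ≤ b), κ y a b ha hb = seg a b (.inl h) := by
    intro y a b ha hb h
    rw [← hκ y a b ha hb (seg (E := F y) ⟨a, ha⟩ ⟨b, hb⟩ (.inl h)), inclPath_seg]
  have κ_mono : ∀ y z a b ha hb (h : y ≤ z), κ z a b ha hb = κ y a b (hF h ha) (hF h hb) := by
    intro y z a b ha hb h
    obtain ⟨φ⟩ := (hf z).nonempty_hom ⟨a, ha⟩ ⟨b, hb⟩
    obtain ⟨ψ, hψ⟩ := exists_inclPath_eq (hF h) φ
    rw [← hκ z a b ha hb φ, ← hψ, hκ]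
  choose s hs using fun y => (hf y).nonempty.elim fun a => (⟨a.1, a.2⟩ : ∃ a, a ∈ F y)
  obtain ⟨G, hG_id, hG_comp, hG_seg⟩ := exists_lift (C := HomotopyGroupoid X)
    (fun y => pt (s y)) (fun y z h => κ y (s y) (s z) (hs y) (hF h (hs z)))
    (fun y z w h h' => by
      rw [κ_mono y z (s z) (s w) (hs z) (hF h' (hs w)) h, κ_comp])
  have hself : ∀ a, a ∈ F (f a) := fun a => le_rfl
  let η : ∀ a, pt (s (f a)) ⟶ pt a := fun a => κ (f a) (s (f a)) a (hs _) (hself a)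
  have hη : ∀ (a b : X) (h : a ≤ b),
      η a ≫ seg a b (.inl h) = G _ _ (seg (f a) (f b) (.inl (f.monotone h))) ≫ η b := by
    intro a b h
    have hb : b ∈ F (f a) := f.monotone h
    simp only [η]
    rw [hG_seg _ _ (f.monotone h), κ_mono (f a) (f b) _ _ _ _ (f.monotone h), κ_comp,
      ← κ_seg (f a) a b (hself a) hb h, κ_comp]
  have key : ∀ {a b : X} (φ : pt a ⟶ pt b), η a ≫ φ = G _ _ (pushPath f φ) ≫ η b := by
    intro a b φ
    refine induction (fun b φ => η a ≫ φ = G _ _ (pushPath f φ) ≫ η b) ?_ ?_ ?_ φ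
    · rw [pushPath_id, hG_id, Category.id_comp, Category.comp_id]
    · intro b c φ h ih
      rw [pushPath_comp, hG_comp, ← Category.assoc, ih, Category.assoc, hη b c h, pushPath_seg,
        Category.assoc]
    · intro b c φ h ih
      have := isIso_seg c b (.inl h)
      rw [← cancel_mono (seg c b (.inl h)), Category.assoc, Category.assoc, seg_down_up _ _ h,
        Category.comp_id, Category.assoc, hη c b h, ih, pushPath_comp, hG_comp, Category.assoc,
        ← Category.assoc (G _ _ (pushPath f (seg b c _))), ← hG_comp, pushPath_seg,
        seg_down_up _ _ (f.monotone h), hG_id, Category.id_comp]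
  intro φ ψ h
  have h' : pushPath f (x := x) (y := x) φ = pushPath f (x := x) (y := x) ψ := h
  have h₁ := key (a := x) (b := x) φ
  rw [h', ← key (a := x) (b := x) ψ] at h₁
  exact (cancel_epi (η x)).1 h₁

end

/-! ### Divisibility in a locally Garside germ -/

namespace Germ

section

variable {O : Type u} [Germ.{u, v} O]

theorem toCat_comp {A B C : O} {a : A ⟶ B} {b : B ⟶ C} {c : A ⟶ C} (h : mul a b = some c) :
    toCat a ≫ toCat b = toCat c :=
  ((Quotient.functor (Rel O)).map_comp _ _).symm.trans
    (CategoryTheory.Quotient.sound _ (Rel.mul a b c h))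

theorem toCat_one (A : O) : toCat (one A) = 𝟙 (obj A) :=
  (CategoryTheory.Quotient.sound _ (Rel.one A)).trans ((Quotient.functor (Rel O)).map_id _)

/-- Induction on the morphisms of the generated category with a given target, by left
multiplication by morphisms of the germ. -/
theorem cat_induction {B : O} (P : ∀ A : O, (obj A ⟶ obj B) → Prop) (id : P B (𝟙 (obj B)))
    (comp : ∀ (A C : O) (x : A ⟶ C) (h : obj C ⟶ obj B), P C h → P A (toCat x ≫ h))
    {A : O} (g : obj A ⟶ obj B) : P A g := by
  obtain ⟨p, rfl⟩ := (Quotient.functor (Rel O)).map_surjective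
    (X := (Paths.of O).obj A) (Y := (Paths.of O).obj B) g
  refine Paths.induction_fixed_target (b := (Paths.of O).obj B)
    (fun {a} (q : a ⟶ (Paths.of O).obj B) => P a ((Quotient.functor (Rel O)).map q)) ?_ ?_ p
  · exact id
  · intro A C q x hq
    exact (congrArg (P A) ((Quotient.functor (Rel O)).map_comp _ _)).mpr (comp A C x _ hq)

/-- A morphism of the germ as an element of the poset of morphisms with the same source. -/
abbrev From.mk {A B : O} (x : A ⟶ B) : From A := ⟨B, x⟩

/-- The morphism `x` of the germ is some `1_A`. -/
def IsIdentity {A C : O} (x : A ⟶ C) : Prop := From.mk x = From.mk (one A)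

/-- Two equal elements of `From A` may be replaced by each other, together with their targets. -/
theorem From.subst {A C D : O} {x : A ⟶ C} {y : A ⟶ D} (h : From.mk x = From.mk y)
    (P : ∀ E : O, (A ⟶ E) → Prop) (hP : P D y) : P C x := by
  have : ∀ z : From A, z = From.mk y → P z.1 z.2 := by
    rintro _ rfl
    exact hP
  exact this _ h

theorem IsIdentity.subst {A C : O} {x : A ⟶ C} (h : IsIdentity x)
    (P : ∀ E : O, (A ⟶ E) → Prop) (hP : P A (one A)) : P C x := From.subst h P hP

theorem isIdentity_one (A : O) : IsIdentity (one A) := rfl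

theorem mul_assoc_of_eq_some {A B C D : O} {a : A ⟶ B} {b : B ⟶ C} {c : C ⟶ D}
    {ab : A ⟶ C} {bc : B ⟶ D} (h : mul a b = some ab) (h' : mul b c = some bc) :
    mul ab c = mul a bc := by
  have := assoc a b c
  rwa [h, h'] at this

theorem exists_mul_right {A B C D : O} {a : A ⟶ B} {b : B ⟶ C} {c : C ⟶ D}
    {ab : A ⟶ C} {d : A ⟶ D} (h : mul a b = some ab) (h' : mul ab c = some d) :
    ∃ bc, mul b c = some bc ∧ mul a bc = some d := by
  have := assoc a b c
  rw [h, Option.bind_some, h'] at this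
  exact Option.bind_eq_some_iff.1 this.symm

theorem exists_mul_left {A B C D : O} {a : A ⟶ B} {b : B ⟶ C} {c : C ⟶ D}
    {bc : B ⟶ D} {d : A ⟶ D} (h : mul b c = some bc) (h' : mul a bc = some d) :
    ∃ ab, mul a b = some ab ∧ mul ab c = some d := by
  have := assoc a b c
  rw [h, Option.bind_some, h'] at this
  exact Option.bind_eq_some_iff.1 this

theorem From.le_iff {A B C : O} {x : A ⟶ B} {y : A ⟶ C} :
    From.mk x ≤ From.mk y ↔ ∃ z : B ⟶ C, mul x z = some y := Iff.rfl

theorem one_le {A : O} (x : From A) : From.mk (one A) ≤ x := ⟨x.2, one_mul _⟩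

end

/-- Below a given element, induction from larger to smaller elements is allowed. -/
theorem _root_.NoetherianPreorder.wellFounded {α : Type*} [Preorder α]
    (h : NoetherianPreorder α) (y : α) :
    WellFounded (fun a b : {v : α // v ≤ y} => b.1 ≤ a.1 ∧ b.1 ≠ a.1) := by
  rw [wellFounded_iff_isEmpty_descending_chain]
  refine ⟨fun ⟨f, hf⟩ => h ⟨fun n => (f n).1, ⟨y, ?_⟩, hf⟩⟩
  rintro _ ⟨n, rfl⟩
  exact (f n).2

theorem _root_.NoetherianPreorder.le_antisymm {α : Type*} [Preorder α]
    (h : NoetherianPreorder α) {x y : α} (hxy : x ≤ y) (hyx : y ≤ x) : x = y := by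
  by_contra hne
  refine ((h.wellFounded x).asymmetric (a := ⟨x, le_rfl⟩) (b := ⟨y, hyx⟩)) ?_ ?_
  · exact ⟨hyx, fun h => hne h.symm⟩
  · exact ⟨hxy, hne⟩

namespace LeftLocallyGarside

variable {O : Type u} [Germ.{u, v} O]

theorem le_antisymm (hO : LeftLocallyGarside O) {A : O} {x y : From A} (hxy : x ≤ y)
    (hyx : y ≤ x) : x = y :=
  (hO.noetherian A).le_antisymm hxy hyx

theorem toCat_injective (hO : LeftLocallyGarside O) {A B : O} {x y : A ⟶ B}
    (h : toCat x = toCat y) : x = y :=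
  hO.cancel (𝟙 (obj A)) x y (by rw [h])

theorem mul_left_cancel (hO : LeftLocallyGarside O) {A B C : O} {x : A ⟶ B} {a b : B ⟶ C}
    {c : A ⟶ C} (ha : mul x a = some c) (hb : mul x b = some c) : a = b :=
  hO.cancel (toCat x) a b ((toCat_comp ha).trans (toCat_comp hb).symm)

theorem le_of_mul_le_mul (hO : LeftLocallyGarside O) {A B C D : O} {x : A ⟶ B} {a : B ⟶ C}
    {b : B ⟶ D} {p : A ⟶ C} {q : A ⟶ D} (ha : mul x a = some p) (hb : mul x b = some q)
    (h : From.mk p ≤ From.mk q) : From.mk a ≤ From.mk b := by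
  obtain ⟨z, hz⟩ := From.le_iff.1 h
  obtain ⟨az, haz, h'⟩ := exists_mul_right ha hz
  rw [hO.mul_left_cancel hb h']
  exact ⟨z, haz⟩

theorem isIdentity_of_mul_eq (hO : LeftLocallyGarside O) {A B C : O} {x : A ⟶ B} {a : B ⟶ C}
    {p : A ⟶ C} (ha : mul x a = some p) (h : From.mk p = From.mk x) : IsIdentity a :=
  hO.le_antisymm (hO.le_of_mul_le_mul ha (mul_one x) h.le) (one_le _)

/-- The greatest divisor `v` of `y` such that `x v` is defined. -/
theorem exists_greatest (hO : LeftLocallyGarside O) {A B : O} (x : A ⟶ B) (y : From B) :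
    ∃ v : From B, v ≤ y ∧ (mul x v.2).isSome ∧
      ∀ v' : From B, v' ≤ y → (mul x v'.2).isSome → v' ≤ v := by
  let S : Set {v : From B // v ≤ y} := {v | (mul x v.1.2).isSome}
  have hS : S.Nonempty := ⟨⟨From.mk (one B), one_le y⟩, by simp [S, mul_one]⟩
  obtain ⟨⟨m, hmy⟩, hm, hmax⟩ := ((hO.noetherian B).wellFounded y).has_min S hS
  refine ⟨m, hmy, hm, fun v hv hxv => ?_⟩
  have hub : y ∈ upperBounds {m, v} := by
    rintro _ (rfl | rfl) <;> assumption
  obtain ⟨d, hd⟩ := hO.exists_lcm m v ⟨y, hub⟩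
  have hmd : m ≤ d := hd.1 (.inl rfl)
  have hxd : (mul x d.2).isSome := hO.mul_lcm x m v d hd hm hxv
  -- `m` is maximal among the `v` considered, so that the lcm `d` of `m` and `v` is `m`
  by_contra hvm
  refine hmax ⟨d, hd.2 hub⟩ hxd ⟨hmd, fun h => hvm ?_⟩
  exact (hd.1 (.inr rfl)).trans (le_of_eq h.symm)

end LeftLocallyGarside

/-! ### The head of a morphism of the generated category -/

section

variable {O : Type u} [Germ.{u, v} O]

/-- `IsGreedy x y v w u`: one has `y = v w` and `x v = u`, where `v` is the greatest divisor of `y`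
such that `x v` is defined. Thus `x y = u w`, and `u` is as large as possible. -/
structure IsGreedy {A B C D : O} (x : A ⟶ B) (y : B ⟶ C) (v : B ⟶ D) (w : D ⟶ C) (u : A ⟶ D) :
    Prop where
  mul_eq : mul v w = some y
  mul_eq' : mul x v = some u
  le : ∀ {E : O} (v' : B ⟶ E), From.mk v' ≤ From.mk y → (mul x v').isSome →
    From.mk v' ≤ From.mk v

theorem LeftLocallyGarside.exists_isGreedy (hO : LeftLocallyGarside O) {A B C : O} (x : A ⟶ B)
    (y : B ⟶ C) : ∃ (D : O) (v : B ⟶ D) (w : D ⟶ C) (u : A ⟶ D), IsGreedy x y v w u := by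
  obtain ⟨⟨D, v⟩, ⟨w, hw⟩, hv, hmax⟩ := hO.exists_greatest x (From.mk y)
  obtain ⟨u, hu⟩ := Option.isSome_iff_exists.1 hv
  exact ⟨D, v, w, u, hw, hu, fun v' => hmax (From.mk v')⟩

/-- The factorizations of morphisms `obj A ⟶ obj B` as a morphism of the germ followed by a
morphism of the generated category. -/
def Factorization (B A : O) := Σ C : O, (A ⟶ C) × (obj C ⟶ obj B)

namespace Factorization

/-- The factorization with factors `a` and `r`. -/
abbrev mk {A B C : O} (a : A ⟶ C) (r : obj C ⟶ obj B) : Factorization B A := ⟨C, a, r⟩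

/-- The morphism that is factorized. -/
def val {A B : O} (m : Factorization B A) : obj A ⟶ obj B := toCat m.2.1 ≫ m.2.2

/-- Left multiplication by a morphism `x` of the germ on factorizations: from `y r` to `(x v)(w r)`,
where `y = v w` and `v` is as large as possible. -/
noncomputable def act (hO : LeftLocallyGarside O) {A B C : O} (x : A ⟶ C)
    (m : Factorization B C) : Factorization B A :=
  mk (hO.exists_isGreedy x m.2.1).choose_spec.choose_spec.choose_spec.choose
    (toCat (hO.exists_isGreedy x m.2.1).choose_spec.choose_spec.choose ≫ m.2.2)

theorem exists_act_eq (hO : LeftLocallyGarside O) {A B C E : O} (x : A ⟶ C) (y : C ⟶ E)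
    (r : obj E ⟶ obj B) : ∃ (D : O) (v : C ⟶ D) (w : D ⟶ E) (u : A ⟶ D), IsGreedy x y v w u ∧
      act hO x (mk y r) = mk u (toCat w ≫ r) :=
  ⟨_, _, _, _, (hO.exists_isGreedy x y).choose_spec.choose_spec.choose_spec.choose_spec, rfl⟩

/-- The action may be computed from any greedy factorization: there is only one, because
divisibility is antisymmetric and the germ is left cancellative. -/
theorem act_eq (hO : LeftLocallyGarside O) {A B C D E : O} {x : A ⟶ C} {y : C ⟶ E} {v : C ⟶ D}
    {w : D ⟶ E} {u : A ⟶ D} (h : IsGreedy x y v w u) (r : obj E ⟶ obj B) :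
    act hO x (mk y r) = mk u (toCat w ≫ r) := by
  obtain ⟨D', v', w', u', h', e⟩ := exists_act_eq hO x y r
  rw [e]
  have hv : From.mk v' = From.mk v := hO.le_antisymm
    (h.le v' ⟨w', h'.mul_eq⟩ (Option.isSome_iff_exists.2 ⟨_, h'.mul_eq'⟩))
    (h'.le v ⟨w, h.mul_eq⟩ (Option.isSome_iff_exists.2 ⟨_, h.mul_eq'⟩))
  clear e
  revert w' u' h'
  refine From.subst hv (fun D' v' => ∀ (w' : D' ⟶ E) (u' : A ⟶ D'), IsGreedy x y v' w' u' →
    mk u' (toCat w' ≫ r) = mk u (toCat w ≫ r)) fun w' u' h' => ?_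
  rw [hO.mul_left_cancel h'.mul_eq h.mul_eq, 
    Option.some_injective _ (h'.mul_eq'.symm.trans h.mul_eq')]

theorem val_act (hO : LeftLocallyGarside O) {A B C : O} (x : A ⟶ C) (m : Factorization B C) :
    (act hO x m).val = toCat x ≫ m.val := by
  obtain ⟨E, y, r⟩ := m
  obtain ⟨D, v, w, u, h, e⟩ := exists_act_eq hO x y r
  rw [e]
  change toCat u ≫ toCat w ≫ r = toCat x ≫ toCat y ≫ r
  rw [← toCat_comp h.mul_eq, ← toCat_comp h.mul_eq', Category.assoc, Category.assoc]

theorem act_one (hO : LeftLocallyGarside O) {A B : O} (m : Factorization B A) :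
    act hO (one A) m = m := by
  obtain ⟨E, y, r⟩ := m
  refine (act_eq hO ⟨mul_one y, one_mul y, fun v' h _ => h⟩ r).trans ?_
  rw [toCat_one, Category.id_comp]

/-- The action is compatible with the products of the germ. If `a b` is defined, the greatest
divisor `v` of `z` with `a b v` defined is found by first extending `b` by a divisor `v₁` of `z`, then
taking the greatest divisor of `b v₁` that `a` can be multiplied by. -/
theorem act_mul (hO : LeftLocallyGarside O) {A B C D : O} {a : A ⟶ C} {b : C ⟶ D} {c : A ⟶ D}
    (h : mul a b = some c) (m : Factorization B D) :
    act hO a (act hO b m) = act hO c m := by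
  obtain ⟨E, z, r⟩ := m
  obtain ⟨F, v₁, w₁, u₁, h₁, e₁⟩ := exists_act_eq hO b z r
  obtain ⟨G, v₂, w₂, u₂, h₂, e₂⟩ := exists_act_eq hO a u₁ (toCat w₁ ≫ r)
  rw [e₁, e₂]
  -- since `a b` is defined, `b` divides `v₂`
  obtain ⟨k, hk⟩ := From.le_iff.1
    (h₂.le b ⟨v₁, h₁.mul_eq'⟩ (Option.isSome_iff_exists.2 ⟨c, h⟩))
  obtain ⟨v₁', hv₁, hb⟩ := exists_mul_right hk h₂.mul_eq
  obtain rfl := hO.mul_left_cancel hb h₁.mul_eq'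
  obtain ⟨w, hw, hkw⟩ := exists_mul_right hv₁ h₁.mul_eq
  have hg : IsGreedy c z k w u₂ := by
    refine ⟨hkw, (mul_assoc_of_eq_some h hk).trans h₂.mul_eq', fun v' hv' hcv' => ?_⟩
    obtain ⟨d, hd⟩ := Option.isSome_iff_exists.1 hcv'
    obtain ⟨bv', hbv', had⟩ := exists_mul_right h hd
    -- `v'` divides `v₁`, then `b v'` divides `v₂ = b k`
    obtain ⟨t, ht⟩ := From.le_iff.1 (h₁.le v' hv' (Option.isSome_iff_exists.2 ⟨_, hbv'⟩))
    obtain ⟨bv'', hbv'', ht'⟩ := exists_mul_left ht h₁.mul_eq'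
    obtain rfl := Option.some_injective _ (hbv'.symm.trans hbv'')
    exact hO.le_of_mul_le_mul hbv' hk
      (h₂.le bv' ⟨t, ht'⟩ (Option.isSome_iff_exists.2 ⟨_, had⟩))
  rw [act_eq hO hg r, ← toCat_comp hw, Category.assoc]

end Factorization

/-- The objects of the germ, in the role of the objects of a category in which the morphisms from `A` to
`C` are the maps from the factorizations with source `C` to those with source `A`. -/
structure FactObj (B : O) where
  as : O

instance (B : O) : Category (FactObj B) where
  Hom A C := Factorization B C.as → Factorization B A.as
  id _ := id
  comp f g := f ∘ g

open Factorization in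
/-- The action on factorizations extended to the generated category. -/
noncomputable def factFunctor (hO : LeftLocallyGarside O) (B : O) : Cat O ⥤ FactObj B :=
  let L : Paths O ⥤ FactObj B :=
    Paths.lift { obj := fun A => ⟨A⟩, map := fun {_ _} x => act hO x }
  have hL : ∀ {A C : O} (x : A ⟶ C), L.map ((Paths.of O).map x) = act hO x :=
    fun x => Category.id_comp _
  CategoryTheory.Quotient.lift (Rel O) L (by
    intro A C p q h
    cases h with
    | mul a b c h =>
      refine (L.map_comp _ _).trans (Eq.trans ?_ (hL c).symm)
      exact (congrArg₂ (· ∘ ·) (hL a) (hL b)).trans (funext fun m => act_mul hO h m)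
    | one A =>
      exact (hL _).trans ((funext fun m => act_one hO m).trans (L.map_id _).symm))

/-- The factorization of a morphism `g` of the generated category whose first term is the
greatest divisor of `g` in the germ, see `LeftLocallyGarside.exists_head`. -/
noncomputable def headFact (hO : LeftLocallyGarside O) {A B : O} (g : obj A ⟶ obj B) :
    Factorization B A :=
  (show Factorization B B → Factorization B A from (factFunctor hO B).map g)
    (Factorization.mk (one B) (𝟙 (obj B)))

theorem headFact_id (hO : LeftLocallyGarside O) (B : O) :
    headFact hO (𝟙 (obj B)) = Factorization.mk (one B) (𝟙 (obj B)) :=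
  congrFun ((factFunctor hO B).map_id (obj B)) _

theorem headFact_comp (hO : LeftLocallyGarside O) {A B C : O} (x : A ⟶ C) (h : obj C ⟶ obj B) :
    headFact hO (toCat x ≫ h) = Factorization.act hO x (headFact hO h) := by
  have h₁ : (factFunctor hO B).map (toCat x) = Factorization.act hO x := Category.id_comp _
  refine (congrFun ((factFunctor hO B).map_comp (toCat x) h) _).trans ?_
  exact congrFun h₁ _

theorem headFact_toCat (hO : LeftLocallyGarside O) {A B : O} (x : A ⟶ B) :
    headFact hO (toCat x) = Factorization.mk x (𝟙 (obj B)) := by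
  have hg : IsGreedy x (one B) (one B) (one B) x := ⟨mul_one _, mul_one _, fun _ h _ => h⟩
  rw [← Category.comp_id (toCat x), headFact_comp, headFact_id, Factorization.act_eq hO hg,
    toCat_one, Category.comp_id]

theorem val_headFact (hO : LeftLocallyGarside O) {A B : O} (g : obj A ⟶ obj B) :
    (headFact hO g).val = g := by
  refine cat_induction (fun A g => (headFact hO g).val = g) ?_ ?_ g
  · rw [headFact_id]
    exact (Category.comp_id _).trans (toCat_one B)
  · intro A C x h ih
    rw [headFact_comp, Factorization.val_act, ih]

namespace LeftLocallyGarside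

theorem le_headFact (hO : LeftLocallyGarside O) {A B C : O} (x : A ⟶ C) (h : obj C ⟶ obj B) :
    From.mk x ≤ From.mk (headFact hO (toCat x ≫ h)).2.1 := by
  rw [headFact_comp]
  obtain ⟨D, v, w, u, hg, e⟩ :=
    Factorization.exists_act_eq hO x (headFact hO h).2.1 (headFact hO h).2.2
  have e' : Factorization.act hO x (headFact hO h) = _ := e
  rw [e']
  exact ⟨v, hg.mul_eq'⟩

/-- Every morphism of the generated category has a greatest divisor in the germ. -/
theorem exists_head (hO : LeftLocallyGarside O) {A B : O} (g : obj A ⟶ obj B) :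
    ∃ (C : O) (a : A ⟶ C) (h : obj C ⟶ obj B), toCat a ≫ h = g ∧
      ∀ {D : O} (x : A ⟶ D) (k : obj D ⟶ obj B), toCat x ≫ k = g →
        From.mk x ≤ From.mk a := by
  refine ⟨_, (headFact hO g).2.1, (headFact hO g).2.2, val_headFact hO g, ?_⟩
  rintro D x k rfl
  exact le_headFact hO x k

/-- The generated category is left cancellative: `x h` determines its head factorization, in which
one cancels `x` by the cancellation property of the germ. -/
theorem comp_left_cancel (hO : LeftLocallyGarside O) {A B C : O} (x : A ⟶ C)
    {h h' : obj C ⟶ obj B} (e : toCat x ≫ h = toCat x ≫ h') : h = h' := by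
  -- `val` recovers a morphism from its head factorization
  have e₁ := congrArg (headFact hO) e
  rw [headFact_comp, headFact_comp] at e₁
  rw [← val_headFact hO h, ← val_headFact hO h']
  generalize headFact hO h = m at e₁
  generalize headFact hO h' = m' at e₁
  obtain ⟨E, y, r⟩ := m
  obtain ⟨E', y', r'⟩ := m'
  obtain ⟨D, v, w, u, hg, e₂⟩ := Factorization.exists_act_eq hO x y r
  obtain ⟨D', v', w', u', hg', e₂'⟩ := Factorization.exists_act_eq hO x y' r'
  have e₃ : Factorization.mk u (toCat w ≫ r) = Factorization.mk u' (toCat w' ≫ r') :=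
    (e₂.symm.trans e₁).trans e₂'
  clear e₂ e₂' e₁
  obtain ⟨rfl, e₄⟩ := Sigma.mk.inj_iff.1 e₃
  obtain ⟨rfl, e₅⟩ := Prod.mk.inj (eq_of_heq e₄)
  obtain rfl := hO.mul_left_cancel hg.mul_eq' hg'.mul_eq'
  change toCat y ≫ r = toCat y' ≫ r'
  rw [← toCat_comp hg.mul_eq, ← toCat_comp hg'.mul_eq, Category.assoc, e₅, Category.assoc]

/-- The divisors of an element of the germ in the generated category are its divisors in the
germ. -/
theorem exists_mul_eq (hO : LeftLocallyGarside O) {A B C : O} {x : A ⟶ C} {h : obj C ⟶ obj B}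
    {y : A ⟶ B} (e : toCat x ≫ h = toCat y) : ∃ t, mul x t = some y ∧ h = toCat t := by
  have hle := le_headFact hO x h
  rw [e, headFact_toCat] at hle
  obtain ⟨t, ht⟩ := From.le_iff.1 hle
  exact ⟨t, ht, hO.comp_left_cancel x (e.trans (toCat_comp ht).symm)⟩

theorem isIdentity_of_isOne_comp (hO : LeftLocallyGarside O) {A B C : O} {x : A ⟶ C}
    {h : obj C ⟶ obj B} (e : IsOne (toCat x ≫ h)) : IsIdentity x := by
  have key : ∀ s : Σ B : O, (obj A ⟶ obj B), s = ⟨A, 𝟙 (obj A)⟩ →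
      ∀ h : obj C ⟶ obj s.1, toCat x ≫ h = s.2 → IsIdentity x := by
    rintro _ rfl h e
    obtain ⟨t, ht, -⟩ := hO.exists_mul_eq (e.trans (toCat_one A).symm)
    exact hO.le_antisymm ⟨t, ht⟩ (one_le _)
  exact key _ e h rfl

/-! ### Noetherianity of the generated category -/

/-- `h` is a proper right factor of `g`: one has `g = x h` for some `x ≠ 1` in the germ. -/
def _root_.Germ.ProperFactor (B : O) (h g : Σ A : O, (obj A ⟶ obj B)) : Prop :=
  ∃ x : g.1 ⟶ h.1, ¬ IsIdentity x ∧ toCat x ≫ h.2 = g.2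

/-- Let `x h = u h'` with `x`, `u` in the germ, and let `x v = u w'` be the lcm of `x` and `u`, so that
`h = v k` and `h' = w' k`. If `v ≠ 1`, then `k` is a proper right factor of `h`; otherwise `k = h`
and `w'` is a proper right factor of `x` in the germ, which is Noetherian. -/
theorem acc_comp (hO : LeftLocallyGarside O) {B C : O} (h : obj C ⟶ obj B)
    (hh : Acc (ProperFactor B) ⟨C, h⟩) {A : O} (y : A ⟶ C) :
    Acc (ProperFactor B) ⟨A, toCat y ≫ h⟩ := by
  suffices H : ∀ s : Σ C : O, (obj C ⟶ obj B), Acc (ProperFactor B) s → ∀ (A : O) (y : A ⟶ s.1),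
      Acc (ProperFactor B) ⟨A, toCat y ≫ s.2⟩ from H _ hh A y
  clear hh h y A C
  intro s hs
  induction hs with
  | intro s _ ih =>
  obtain ⟨C, h⟩ := s
  intro A y
  -- induction on the right factors `w` of `y`, by way of the complementary left divisors `z`
  suffices H : ∀ z : {z : From A // z ≤ From.mk y}, ∀ w : z.1.1 ⟶ C, mul z.1.2 w = some y →
      Acc (ProperFactor B) ⟨z.1.1, toCat w ≫ h⟩ from
    H ⟨From.mk (one A), one_le _⟩ y (one_mul y)
  intro z
  induction z using ((hO.noetherian A).wellFounded (From.mk y)).induction with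
  | _ z ihz =>
  obtain ⟨⟨D, z⟩, hz⟩ := z
  intro (w : D ⟶ C) (hw : mul z w = some y)
  refine Acc.intro _ ?_
  rintro ⟨E, h'⟩ ⟨u, hu, e⟩
  -- the lcm `d = w v = u w'` of `w` and `u` in the germ divides `w h = u h'`
  obtain ⟨F, a, k₀, ha, hmax⟩ := hO.exists_head (toCat w ≫ h)
  have hub : From.mk a ∈ upperBounds {From.mk w, From.mk u} := by
    rintro _ (rfl | rfl)
    · exact hmax w h rfl
    · exact hmax u h' e
  obtain ⟨⟨G, d⟩, hd⟩ := hO.exists_lcm _ _ ⟨_, hub⟩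
  obtain ⟨v, hv⟩ := From.le_iff.1 (hd.1 (.inl rfl))
  obtain ⟨w', hw'⟩ := From.le_iff.1 (hd.1 (.inr rfl))
  obtain ⟨k₁, hk₁⟩ := From.le_iff.1 (hd.2 hub)
  have hk : toCat d ≫ toCat k₁ ≫ k₀ = toCat w ≫ h := by
    rw [← Category.assoc, toCat_comp hk₁, ha]
  generalize toCat k₁ ≫ k₀ = k at hk
  have hh : toCat v ≫ k = h := hO.comp_left_cancel w (by
    rw [← Category.assoc, toCat_comp hv, hk])
  have hh' : h' = toCat w' ≫ k := hO.comp_left_cancel u (by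
    rw [← Category.assoc, toCat_comp hw', hk]; exact e)
  by_cases hv1 : IsIdentity v
  · obtain ⟨t, ht, e'⟩ : ∃ t : E ⟶ C, mul u t = some w ∧ h' = toCat t ≫ h := by
      refine hv1.subst (fun G v => ∀ (d : D ⟶ G) (w' : E ⟶ G) (k : obj G ⟶ obj B),
        mul w v = some d → mul u w' = some d → toCat v ≫ k = h → h' = toCat w' ≫ k →
        ∃ t : E ⟶ C, mul u t = some w ∧ h' = toCat t ≫ h) ?_ d w' k hv hw' hh hh'
      intro d w' k hv hw' hh hh'
      rw [toCat_one, Category.id_comp] at hh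
      rw [mul_one] at hv
      exact ⟨w', hw'.trans hv.symm, by rw [hh', hh]⟩
    obtain ⟨zu, hzu, hy⟩ := exists_mul_left ht hw
    rw [e']
    exact ihz ⟨From.mk zu, t, hy⟩
      ⟨⟨u, hzu⟩, fun h => hu (hO.isIdentity_of_mul_eq hzu h.symm)⟩ t hy
  · rw [hh']
    exact ih ⟨G, k⟩ ⟨v, hv1, hh⟩ E w'

/-- There is no infinite sequence of proper right factors. -/
theorem wellFounded_properFactor (hO : LeftLocallyGarside O) (B : O) :
    WellFounded (ProperFactor B) := by
  have h₁ : Acc (ProperFactor B) ⟨B, 𝟙 (obj B)⟩ := by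
    refine Acc.intro _ ?_
    rintro ⟨E, h'⟩ ⟨u, hu, e⟩
    exact absurd (hO.isIdentity_of_isOne_comp (x := u) (h := h')
      (congrArg (Sigma.mk (β := fun C => obj B ⟶ obj C) B) e)) hu
  refine ⟨fun ⟨A, g⟩ => cat_induction (fun A g => Acc (ProperFactor B) ⟨A, g⟩) h₁ ?_ g⟩
  intro A C x h ih
  exact hO.acc_comp h ih x

end LeftLocallyGarside

end

end Germ

/-! ### Paths from their first term on -/

namespace Germ

open Quiver

section

variable {V : Type u} [Quiver.{v} V]

/-- The first term and the rest of a path, `none` for an empty path. -/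
def pathFront {A : V} : ∀ {B : V}, Path A B → Option (Σ C : V, (A ⟶ C) × Path C B)
  | _, .nil => none
  | _, .cons .nil a => some ⟨_, a, .nil⟩
  | _, .cons (.cons p b) a => (pathFront (.cons p b)).map fun s => ⟨s.1, s.2.1, s.2.2.cons a⟩

theorem pathFront_toPath_comp {A C : V} (x : A ⟶ C) {B : V} (p : Path C B) :
    pathFront (x.toPath.comp p) = some ⟨C, x, p⟩ := by
  induction p with
  | nil => rfl
  | cons p b ih =>
    cases p with
    | nil => rfl
    | cons p c =>
      have : pathFront (x.toPath.comp ((p.cons c).cons b)) =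
        (pathFront (x.toPath.comp (p.cons c))).map fun s => ⟨s.1, s.2.1, s.2.2.cons b⟩ := rfl
      rw [this, ih]
      rfl

theorem path_front_induction {B : V} (P : ∀ A : V, Path A B → Prop) (nil : P B .nil)
    (comp : ∀ (A C : V) (x : A ⟶ C) (p : Path C B), P C p → P A (x.toPath.comp p))
    {A : V} (p : Path A B) : P A p :=
  Paths.induction_fixed_target (b := (Paths.of V).obj B)
    (fun {a} (q : a ⟶ (Paths.of V).obj B) => P a q) nil (fun {C A} q x hq => comp C A x q hq) p

end

section

variable {O : Type u} [Germ.{u, v} O]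

theorem prod_nil (A : O) : prod (.nil : Path A A) = 𝟙 (obj A) :=
  (Quotient.functor (Rel O)).map_id _

theorem prod_comp {A B C : O} (p : Path A B) (q : Path B C) :
    prod (p.comp q) = prod p ≫ prod q :=
  (Quotient.functor (Rel O)).map_comp (X := (Paths.of O).obj A) (Y := (Paths.of O).obj B)
    (Z := (Paths.of O).obj C) p q

theorem prod_toPath {A B : O} (a : A ⟶ B) : prod a.toPath = toCat a := rfl

theorem prod_cons {A B C : O} (p : Path A B) (a : B ⟶ C) :
    prod (p.cons a) = prod p ≫ toCat a := prod_comp p a.toPath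

theorem proper_comp {A B C : O} (p : Path A B) (q : Path B C) :
    Proper (p.comp q) ↔ Proper p ∧ Proper q := by
  induction q with
  | nil => simp [Proper]
  | cons q a ih =>
    change Proper (p.comp q) ∧ _ ↔ Proper p ∧ Proper q ∧ _
    rw [ih, and_assoc]

theorem proper_toPath {A B : O} (a : A ⟶ B) : Proper a.toPath ↔ ¬ IsIdentity a :=
  ⟨fun h => h.2, fun h => ⟨trivial, h⟩⟩

theorem proper_toPath_comp {A B C : O} {a : A ⟶ B} {p : Path B C} :
    Proper (a.toPath.comp p) ↔ ¬ IsIdentity a ∧ Proper p := by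
  rw [proper_comp, proper_toPath]

/-- Every morphism of the generated category has a decomposition: drop the identities from any
expression as a product of morphisms of the germ. -/
theorem exists_proper {A B : O} (g : obj A ⟶ obj B) :
    ∃ p : Path A B, Proper p ∧ prod p = g := by
  refine cat_induction (fun A g => ∃ p : Path A B, Proper p ∧ prod p = g)
    ⟨.nil, trivial, prod_nil B⟩ ?_ g
  rintro A C x h ⟨p, hp, rfl⟩
  by_cases hx : IsIdentity x
  · refine hx.subst (fun C x => ∀ p : Path C B, Proper p →
      ∃ q : Path A B, Proper q ∧ prod q = toCat x ≫ prod p) ?_ p hp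
    intro p hp
    exact ⟨p, hp, by rw [toCat_one, Category.id_comp]⟩
  · exact ⟨x.toPath.comp p, proper_toPath_comp.2 ⟨hx, hp⟩, prod_comp _ _⟩

theorem LeftLocallyGarside.not_isOne_prod (hO : LeftLocallyGarside O) {A C B : O} {x : A ⟶ C}
    (hx : ¬ IsIdentity x) (p : Path C B) : ¬ IsOne (prod (x.toPath.comp p)) := fun h =>
  hx (hO.isIdentity_of_isOne_comp ((congrArg IsOne (prod_comp x.toPath p)).mp h))

theorem LeftLocallyGarside.not_isOne_toCat (hO : LeftLocallyGarside O) {A B : O} {y : A ⟶ B}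
    (hy : ¬ IsIdentity y) : ¬ IsOne (toCat y) := hO.not_isOne_prod hy .nil

theorem exists_eq_toPath_comp {A B : O} {p : Path A B} (hp : ¬ IsOne (prod p)) :
    ∃ (C : O) (x : A ⟶ C) (r : Path C B), p = x.toPath.comp r := by
  revert hp
  refine path_front_induction (fun A p => ¬ IsOne (prod p) →
    ∃ (C : O) (x : A ⟶ C) (r : Path C B), p = x.toPath.comp r) ?_ ?_ p
  · exact fun h => absurd (congrArg (Sigma.mk B) (prod_nil B)) h
  · exact fun A C x r _ _ => ⟨C, x, r, rfl⟩

/-- An identity has no other decomposition than the empty one. -/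
theorem LeftLocallyGarside.eq_nil (hO : LeftLocallyGarside O) {A : O} {p : Path A A}
    (hp : Proper p) (h : prod p = 𝟙 (obj A)) : p = .nil := by
  have key : ∀ {B : O} (p : Path B A), Proper p → IsOne (prod p) → p.length = 0 := by
    intro B p
    refine path_front_induction (fun B p => Proper p → IsOne (prod p) → p.length = 0)
      (fun _ _ => rfl) (fun B C x p _ hp h => ?_) p
    exact absurd h (hO.not_isOne_prod (proper_toPath_comp.1 hp).1 p)
  exact Path.eq_nil_of_length_zero p (key p hp (congrArg (Sigma.mk A) h))

theorem exists_toCat_eq_of_isOne {A B C : O} (x : A ⟶ C) {h : obj C ⟶ obj B} (hh : IsOne h) :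
    ∃ y : A ⟶ B, toCat y = toCat x ≫ h := by
  have key : ∀ s : Σ B : O, (obj C ⟶ obj B), s = ⟨C, 𝟙 (obj C)⟩ →
      ∃ y : A ⟶ s.1, toCat y = toCat x ≫ s.2 := by
    rintro _ rfl
    exact ⟨x, (Category.comp_id _).symm⟩
  exact key _ hh

/-! ### Refinement of decompositions -/

/-- `Refine p q`: the path `p` is obtained from `q` by replacing each term by a path with the same
product. -/
def Refine {A : O} : ∀ {B : O}, Path A B → Path A B → Prop
  | _, p, .nil => p = .nil
  | D, p, .cons (b := C) q c =>
    ∃ (p' : Path A C) (s : Path C D), p = p'.comp s ∧ Refine p' q ∧ prod s = toCat c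

theorem refine_refl {A B : O} (p : Path A B) : Refine p p := by
  induction p with
  | nil => rfl
  | cons p a ih => exact ⟨p, a.toPath, rfl, ih, rfl⟩

theorem refine_comp {A B C : O} {p q : Path A B} {p' q' : Path B C} (h : Refine p q)
    (h' : Refine p' q') : Refine (p.comp p') (q.comp q') := by
  induction q' with
  | nil =>
    obtain rfl : p' = .nil := h'
    exact h
  | cons q' a ih =>
    obtain ⟨r, s, rfl, hr, hs⟩ := h'
    exact ⟨p.comp r, s, (Path.comp_assoc _ _ _).symm, ih hr, hs⟩

theorem exists_of_refine_comp {A B C : O} {p : Path A C} {q : Path A B} {q' : Path B C}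
    (h : Refine p (q.comp q')) :
    ∃ p₁ p₂, p = Path.comp p₁ p₂ ∧ Refine p₁ q ∧ Refine p₂ q' := by
  induction q' with
  | nil => exact ⟨p, .nil, rfl, h, rfl⟩
  | cons q' a ih =>
    obtain ⟨r, s, rfl, hr, hs⟩ := h
    obtain ⟨p₁, p₂, rfl, h₁, h₂⟩ := ih hr
    exact ⟨p₁, p₂.comp s, Path.comp_assoc _ _ _, h₁, p₂, s, rfl, h₂, hs⟩

theorem refine_toPath {A B : O} {p : Path A B} {c : A ⟶ B} :
    Refine p c.toPath ↔ prod p = toCat c := by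
  constructor
  · rintro ⟨p', s, rfl, h, hs⟩
    obtain rfl : p' = .nil := h
    rwa [Path.nil_comp]
  · exact fun h => ⟨.nil, p, (Path.nil_comp p).symm, rfl, h⟩

theorem prod_eq_of_split {A B : O} {p q : Path A B} (h : Split p q) : prod p = prod q := by
  obtain ⟨l, a, b, c, h, r⟩ := h
  rw [prod_comp, prod_comp, prod_cons, prod_cons, prod_cons, Category.assoc (prod l),
    toCat_comp h]

/-- `Refine` absorbs the generators of the order on decompositions. Together with
`LeftLocallyGarside.reflTransGen_split_of_refine`, this identifies it with that order. -/
theorem refine_of_split {A B : O} {p q q' : Path A B} (h : Refine p q) (hq : Split q q') :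
    Refine p q' := by
  obtain ⟨l, a, b, c, hc, r⟩ := hq
  obtain ⟨p₁, p₂, rfl, ⟨p₃, s, rfl, ⟨p₄, t, rfl, h₄, ht⟩, hs⟩, h₂⟩ := exists_of_refine_comp h
  refine refine_comp ⟨p₄, t.comp s, Path.comp_assoc _ _ _, h₄, ?_⟩ h₂
  rw [prod_comp, ht, hs, toCat_comp hc]

theorem split_comp_right {A B C : O} {p q : Path A B} (h : Split p q) (r : Path B C) :
    Split (p.comp r) (q.comp r) := by
  obtain ⟨l, a, b, c, h, r'⟩ := h
  rw [Path.comp_assoc, Path.comp_assoc]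
  exact .mk l a b c h _

theorem split_comp_left {A B C : O} (l : Path A B) {p q : Path B C} (h : Split p q) :
    Split (l.comp p) (l.comp q) := by
  obtain ⟨l', a, b, c, h, r⟩ := h
  rw [← Path.comp_assoc, ← Path.comp_assoc]
  exact .mk (l.comp l') a b c h r

namespace LeftLocallyGarside

theorem proper_of_split (hO : LeftLocallyGarside O) {A B : O} {p q : Path A B} (h : Split p q)
    (hp : Proper p) : Proper q := by
  obtain ⟨l, a, b, c, h, r⟩ := h
  rw [proper_comp] at hp ⊢
  refine ⟨⟨hp.1.1.1, fun hc => hp.1.1.2 ?_⟩, hp.2⟩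
  -- a product is an identity only if its first factor is one
  have hac : From.mk a ≤ From.mk c := ⟨b, h⟩
  have hc' : From.mk c = From.mk (one _) := hc
  exact hO.le_antisymm (le_trans hac (le_of_eq hc')) (one_le _)

/-- A decomposition with at least one term of an element of the germ can be collapsed to this
element. -/
theorem reflTransGen_split_toPath (hO : LeftLocallyGarside O) {A B : O} (p : Path A B)
    (hp : Proper p) {c : A ⟶ B} (hc : ¬ IsIdentity c) (h : prod p = toCat c) :
    Relation.ReflTransGen Split p c.toPath := by
  revert c
  refine path_front_induction (fun A p => Proper p → ∀ {c : A ⟶ B}, ¬ IsIdentity c →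
    prod p = toCat c → Relation.ReflTransGen Split p c.toPath) ?_ ?_ p hp
  · intro _ c hc h
    refine absurd ?_ hc
    rw [prod_nil, ← toCat_one] at h
    rw [← hO.toCat_injective h]
    exact isIdentity_one B
  · intro A C x p ih hp c hc h
    obtain ⟨hx, hp⟩ := proper_toPath_comp.1 hp
    rw [prod_comp] at h
    obtain ⟨t, ht, ht'⟩ := hO.exists_mul_eq h
    by_cases h1 : IsIdentity t
    · have key : ∀ p : Path C B, Proper p → prod p = toCat t → mul x t = some c →
          x.toPath.comp p = c.toPath := by
        refine h1.subst (fun B t => ∀ (c : A ⟶ B) (p : Path C B), Proper p → prod p = toCat t →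
          mul x t = some c → x.toPath.comp p = c.toPath) ?_ c
        intro c p hp h ht
        rw [hO.eq_nil hp (h.trans (toCat_one _))]
        rw [mul_one] at ht
        rw [Option.some_injective _ ht]
        rfl
      rw [key p hp ht' ht]
    · exact ((ih hp h1 ht').lift (fun r => x.toPath.comp r) fun _ _ => split_comp_left _).tail
        (.mk .nil x t c ht .nil)

theorem reflTransGen_split_of_refine (hO : LeftLocallyGarside O) {A B : O} {p q : Path A B}
    (hp : Proper p) (hq : Proper q) (h : Refine p q) : Relation.ReflTransGen Split p q := by
  induction q with
  | nil =>
    obtain rfl : p = .nil := h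
    exact .refl
  | cons q c ih =>
    obtain ⟨p', s, rfl, h', hs⟩ := h
    obtain ⟨hp', hs'⟩ := (proper_comp _ _).1 hp
    refine ((ih hp' hq.1 h').lift (fun r => r.comp s) fun _ _ h => split_comp_right h s).trans ?_
    exact (hO.reflTransGen_split_toPath s hs' hq.2 hs).lift (fun r => q.comp r)
      fun _ _ => split_comp_left q

theorem decomp_le_iff (hO : LeftLocallyGarside O) {A B : O} {g : obj A ⟶ obj B}
    {p q : Decomp g} : p ≤ q ↔ Refine p.path q.path := by
  constructor
  · intro h
    induction h with
    | refl => exact refine_refl _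
    | tail _ h ih => exact refine_of_split ih h
  · intro h
    obtain ⟨p, hp, hpg⟩ := p
    obtain ⟨q, hq, hqg⟩ := q
    have h' := hO.reflTransGen_split_of_refine hp hq h
    clear h
    change Relation.ReflTransGen Split p q at h'
    induction h' using Relation.ReflTransGen.head_induction_on with
    | refl => exact le_rfl
    | head h _ ih =>
      exact Relation.ReflTransGen.head h
        (ih (hO.proper_of_split h hp) ((prod_eq_of_split h).symm.trans hpg))

/-- If `x r` refines `y w`, then `y` is a multiple `x t` of `x` in the germ, and `r` is a refinement
of `t w`. -/
theorem exists_of_refine_toPath_comp (hO : LeftLocallyGarside O) {A B C D : O} {x : A ⟶ C}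
    {r : Path C B} {y : A ⟶ D} {w : Path D B} (hy : ¬ IsIdentity y)
    (h : Refine (x.toPath.comp r) (y.toPath.comp w)) :
    ∃ t, mul x t = some y ∧ ∃ s p, r = Path.comp s p ∧ prod s = toCat t ∧ Refine p w := by
  obtain ⟨p₁, p₂, e, h₁, h₂⟩ := exists_of_refine_comp h
  rw [refine_toPath] at h₁
  obtain ⟨C', x', s, rfl⟩ := exists_eq_toPath_comp (p := p₁) (h₁ ▸ hO.not_isOne_toCat hy)
  have e' := congrArg pathFront (e.trans (Path.comp_assoc _ _ _))
  rw [pathFront_toPath_comp, pathFront_toPath_comp] at e'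
  obtain ⟨rfl, e₁⟩ := Sigma.mk.inj_iff.1 (Option.some_injective _ e')
  obtain ⟨rfl, rfl⟩ := Prod.mk.inj (eq_of_heq e₁)
  rw [prod_comp] at h₁
  obtain ⟨t, ht, hs⟩ := hO.exists_mul_eq h₁
  exact ⟨t, ht, s, p₂, rfl, hs, h₂⟩

/-- If `y = x t` in the germ, then `x r` refines `y w` for a proper path `r` that is itself refined
by all the others: take `r = t w`, or `r = w` if `t` is an identity, since identities are not
allowed as terms. -/
theorem exists_coarsest (hO : LeftLocallyGarside O) {A B C D : O} {x : A ⟶ C} {t : C ⟶ D}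
    {y : A ⟶ D} (ht : mul x t = some y) {w : Path D B} (hw : Proper w) :
    ∃ r : Path C B, Proper r ∧ prod r = toCat t ≫ prod w ∧
      Refine (x.toPath.comp r) (y.toPath.comp w) ∧
      ∀ s p, Proper s → prod s = toCat t → Refine p w → Refine (Path.comp s p) r := by
  by_cases h1 : IsIdentity t
  · refine h1.subst (fun D t => ∀ (y : A ⟶ D) (w : Path D B), mul x t = some y → Proper w →
      ∃ r : Path C B, Proper r ∧ prod r = toCat t ≫ prod w ∧
        Refine (x.toPath.comp r) (y.toPath.comp w) ∧
        ∀ s p, Proper s → prod s = toCat t → Refine p w → Refine (Path.comp s p) r) ?_ y w ht hw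
    intro y w ht hw
    rw [mul_one] at ht
    obtain rfl := Option.some_injective _ ht
    refine ⟨w, hw, by rw [toCat_one, Category.id_comp], refine_refl _, fun s p hs hst hp => ?_⟩
    rw [hO.eq_nil hs (hst.trans (toCat_one C)), Path.nil_comp]
    exact hp
  · refine ⟨t.toPath.comp w, proper_toPath_comp.2 ⟨h1, hw⟩, prod_comp _ _, ?_, ?_⟩
    · rw [← Path.comp_assoc]
      refine refine_comp (refine_toPath.2 ?_) (refine_refl w)
      exact (prod_comp _ _).trans (toCat_comp ht)
    · exact fun s p _ hst hp => refine_comp (refine_toPath.2 hst) hp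

/-! ### Simple connectedness of the posets of decompositions -/

/-- The map from the decompositions of `h` to those of `g = x h` that adds `x` as first term. -/
def _root_.Germ.Decomp.addFirst (hO : LeftLocallyGarside O) {A B C : O} {x : A ⟶ C}
    (hx : ¬ IsIdentity x) {h : obj C ⟶ obj B} {g : obj A ⟶ obj B} (hg : toCat x ≫ h = g) :
    Decomp h →o Decomp g where
  toFun r := ⟨x.toPath.comp r.path, proper_toPath_comp.2 ⟨hx, r.proper⟩, by
    rw [prod_comp, r.prod_eq]; exact hg⟩
  monotone' r r' hr := by
    rw [hO.decomp_le_iff] at hr ⊢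
    exact refine_comp (refine_refl x.toPath) hr

/-- A decomposition lies above some `x r` exactly when its first term is a multiple `x t` of `x`, and
replacing `x t` by `t` gives the greatest such `r`. So the decompositions of `g = x h` with first
term a multiple of `x` retract onto the decompositions of `h`. -/
theorem simplyConnected_addFirst (hO : LeftLocallyGarside O) {A B C : O} {x : A ⟶ C}
    (hx : ¬ IsIdentity x) {h : obj C ⟶ obj B} {g : obj A ⟶ obj B} (hg : toCat x ≫ h = g)
    (hh : PosetSimplyConnected (Decomp h)) :
    PosetSimplyConnected {u : Decomp g | ∃ r, Decomp.addFirst hO hx hg r ≤ u} := by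
  refine hh.of_isGreatest _ ?_
  rintro ⟨u, hu, hug⟩ ⟨r, hr⟩
  have hg1 : ¬ IsOne (prod u) := by
    rw [hug, ← hg]
    exact fun h => hx (hO.isIdentity_of_isOne_comp h)
  obtain ⟨D, y, w, rfl⟩ := exists_eq_toPath_comp hg1
  obtain ⟨hy, hw⟩ := proper_toPath_comp.1 hu
  obtain ⟨t, ht, -⟩ := hO.exists_of_refine_toPath_comp hy (hO.decomp_le_iff.1 hr)
  obtain ⟨m, hm, hmt, hle, hmax⟩ := hO.exists_coarsest ht hw
  have hmh : prod m = h := hO.comp_left_cancel x (by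
    rw [hmt, ← Category.assoc, toCat_comp ht, hg, ← hug, prod_comp, prod_toPath])
  refine ⟨⟨m, hm, hmh⟩, hO.decomp_le_iff.2 hle, fun r' hr' => ?_⟩
  obtain ⟨t', ht', s, p, e, hs, hp⟩ :=
    hO.exists_of_refine_toPath_comp hy (hO.decomp_le_iff.1 hr')
  obtain rfl := hO.mul_left_cancel ht ht'
  have hsp := r'.proper
  rw [e, proper_comp] at hsp
  rw [hO.decomp_le_iff, e]
  exact hmax s p hsp.1 hs hp

theorem simplyConnected_decomp_toCat (hO : LeftLocallyGarside O) {A B : O} {y : A ⟶ B}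
    (hy : ¬ IsIdentity y) : PosetSimplyConnected (Decomp (toCat y)) :=
  .of_isTop ⟨y.toPath, (proper_toPath y).2 hy, rfl⟩ fun q =>
    hO.decomp_le_iff.2 (refine_toPath.2 q.prod_eq)

theorem simplyConnected_decomp (hO : LeftLocallyGarside O) {A B : O} (g : obj A ⟶ obj B)
    (hg : ¬ IsOne g) : PosetSimplyConnected (Decomp g) := by
  suffices H : ∀ s : Σ A : O, (obj A ⟶ obj B), ¬ IsOne s.2 → PosetSimplyConnected (Decomp s.2)
    from H ⟨A, g⟩ hg
  clear hg g A
  intro s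
  induction s using (hO.wellFounded_properFactor B).induction with
  | _ s ih =>
  obtain ⟨A, g⟩ := s
  intro (hg : ¬ IsOne g)
  change PosetSimplyConnected (Decomp g)
  by_cases hP : ∃ y : A ⟶ B, toCat y = g
  · obtain ⟨y, rfl⟩ := hP
    refine hO.simplyConnected_decomp_toCat fun hy => hg ?_
    exact hy.subst (fun B y => IsOne (toCat y)) (congrArg (Sigma.mk A) (toCat_one A))
  have hright : ∀ {C : O} {x : A ⟶ C} {h : obj C ⟶ obj B}, toCat x ≫ h = g → ¬ IsOne h := by
    rintro C x h e hh
    obtain ⟨y, hy⟩ := exists_toCat_eq_of_isOne x hh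
    exact hP ⟨y, hy.trans e⟩
  -- every decomposition `q` is written `x r`
  have hfront : ∀ q : Decomp g, ∃ (C : O) (x : A ⟶ C) (r : Path C B), ¬ IsIdentity x ∧
      Proper r ∧ toCat x ≫ prod r = g ∧ q.path = x.toPath.comp r := by
    rintro ⟨q, hq, rfl⟩
    obtain ⟨C, x, r, rfl⟩ := exists_eq_toPath_comp hg
    obtain ⟨hx, hr⟩ := proper_toPath_comp.1 hq
    exact ⟨C, x, r, hx, hr, (prod_comp _ _).symm, rfl⟩
  choose C x r hx hr hxr hq using hfront
  -- the base point: a decomposition whose first term is the head `a` of `g`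
  obtain ⟨D, a, h, hah, hmax⟩ := hO.exists_head g
  obtain ⟨w, hw, rfl⟩ := exists_proper h
  have ha : ¬ IsIdentity a := by
    intro ha
    obtain ⟨q, hq, hqg⟩ := exists_proper g
    have hle : From.mk (x ⟨q, hq, hqg⟩) ≤ From.mk a := hmax _ _ (hxr _)
    have ha' : From.mk a = From.mk (one A) := ha
    exact hx ⟨q, hq, hqg⟩ (hO.le_antisymm (ha' ▸ hle) (one_le _))
  let e : Decomp g := ⟨a.toPath.comp w, proper_toPath_comp.2 ⟨ha, hw⟩, (prod_comp _ _).trans hah⟩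
  -- the covering set of `q` consists of the decompositions whose first term is a multiple of the
  -- first term `x q` of `q`
  refine .of_cover e (fun q => {u | ∃ s, Decomp.addFirst hO (hx q) (hxr q) s ≤ u}) ?_ ?_ ?_ ?_
  · exact fun q => hO.simplyConnected_addFirst (hx q) (hxr q)
      (ih ⟨C q, prod (r q)⟩ ⟨x q, hx q, hxr q⟩ (hright (hxr q)))
  · intro q
    obtain ⟨t, ht⟩ := From.le_iff.1 (hmax _ _ (hxr q))
    obtain ⟨m, hm, hmt, hle, -⟩ := hO.exists_coarsest ht hw
    refine ⟨⟨m, hm, hO.comp_left_cancel (x q) ?_⟩, hO.decomp_le_iff.2 hle⟩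
    rw [hmt, ← Category.assoc, toCat_comp ht, hah, hxr]
  · intro q
    refine ⟨⟨r q, hr q, rfl⟩, hO.decomp_le_iff.2 ?_⟩
    rw [hq q]
    exact refine_refl _
  · rintro q q' hqq' u ⟨s, hs⟩
    rw [hO.decomp_le_iff, hq q, hq q'] at hqq'
    obtain ⟨t, ht, -⟩ := hO.exists_of_refine_toPath_comp (hx q') hqq'
    obtain ⟨m, hm, hmt, hle, -⟩ := hO.exists_coarsest ht s.proper
    refine ⟨⟨m, hm, hO.comp_left_cancel (x q) ?_⟩, le_trans
      ((hO.decomp_le_iff (q := Decomp.addFirst hO (hx q') (hxr q') s)).2 hle) hs⟩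
    rw [hmt, s.prod_eq, ← Category.assoc, toCat_comp ht, hxr, hxr]

end LeftLocallyGarside

end

end Germ

theorem mainTheorem3 :
    (∀ (O : Type u) [Germ.{u, v} O], Germ.LeftLocallyGarside O →
      ∀ {A B : O} (g : Germ.obj A ⟶ Germ.obj B), ¬ Germ.IsOne g →
        PosetSimplyConnected (Germ.Decomp g)) ∧
    (∀ (X : Type u) (Y : Type v) [PartialOrder X] [PartialOrder Y] (f : X →o Y),
      PosetConnected Y →
      ((∀ y : Y, (f ⁻¹' Set.Ici y).Nonempty ∧ PosetConnected (f ⁻¹' Set.Ici y)) →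
        ∀ x : X, Function.Surjective (piOneMap f x)) ∧
      ((∀ y : Y, PosetSimplyConnected (f ⁻¹' Set.Ici y)) →
        ∀ x : X, Function.Bijective (piOneMap f x))) := by
  refine ⟨fun O _ hO A B g hg => hO.simplyConnected_decomp g hg, fun X Y _ _ f _ => ⟨fun hf x => ?_,
    fun hf x => ⟨piOneMap_injective f hf x, ?_⟩⟩⟩
  · exact piOneMap_surjective f hf x
  · exact piOneMap_surjective f
      (fun y => ⟨Set.nonempty_coe_sort.1 (hf y).nonempty, (hf y).connected⟩) x
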